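/- Let $X$ be a locally finite tree (viewed as a topological space, with its usual CW topology). Let $\mathrm{Maps}(X)$ be the group of proper homotopy equivalences $X\to X$ modulo proper homotopy. It is topologized as follows: let $\hat X=X\sqcup\partial X$ be the end compactification of $X$, let $C(\hat X,\hat X)$ be the space of continuous maps $\hat X\to\hat X$ with the compact-open topology, and let $PH(X)\subset C(\hat X,\hat X)^2$ be the subspace of the pairs $(\hat f,\hat g)$ that extend proper maps $f,g:X\to X$ for which $f\circ g$ and $g\circ f$ are properly homotopic to the identity; then $\mathrm{Maps}(X)$ carries the quotient topology under $PH(X)\to\mathrm{Maps}(X)$, $(\hat f,\hat g)\mapsto[f]$. **Theorem.** Let $H<\mathrm{Maps}(X)$ be a compact subgroup. Then there are a locally finite tree $Y$, a proper homotopy equivalence $F:X\to Y$ with proper homotopy inverse $F':Y\to X$, and an action of $H$ on $Y$ by simplicial isomorphisms, i.e. a homomorphism $\rho:H\to\mathrm{Aut}(Y)$, that realizes $H$: for every $h=[f]\in H$ the homeomorphism of $Y$ induced by $\rho(h)$ is properly homotopic to $F\circ f\circ F'$. In other words, under the isomorphism $\mathrm{Maps}(X)\cong\mathrm{Maps}(Y)$,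 $[f]\mapsto[F\circ f\circ F']$, the group $H$ is realized as a group of simplicial isomorphisms of $Y$. -/

import Mathlib

universe u v w

namespace GraphMaps

open Set Topology TopologicalSpace
open scoped unitInterval

/-! ## Proper homotopy -/

section ProperHomotopy

variable {X : Type u} {Y : Type v} {Z : Type w}
  [TopologicalSpace X] [TopologicalSpace Y] [TopologicalSpace Z]

/-- Two maps are properly homotopic if they are joined by a homotopy `I × X → Y` that is itself a
proper map. -/
def ProperlyHomotopic (f g : C(X, Y)) : Prop :=
  ∃ H : ContinuousMap.Homotopy f g, IsProperMap H

theorem isProperMap_of_cover {A B : Type*} [TopologicalSpace A] [TopologicalSpace B]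
    {K : B → Y} (hK : Continuous K) {a b : A → B} (ha : Continuous a) (hb : Continuous b)
    (hab : ∀ z, z ∈ range a ∨ z ∈ range b) (h₁ : IsProperMap (K ∘ a))
    (h₂ : IsProperMap (K ∘ b)) : IsProperMap K := by
  rw [isProperMap_iff_isClosedMap_and_compact_fibers]
  refine ⟨hK, fun C hC => ?_, fun y => ?_⟩
  · have : K '' C = (K ∘ a) '' (a ⁻¹' C) ∪ (K ∘ b) '' (b ⁻¹' C) := by
      ext y
      constructor
      · rintro ⟨z, hz, rfl⟩
        rcases hab z with ⟨x, rfl⟩ | ⟨x, rfl⟩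
        · exact Or.inl ⟨x, hz, rfl⟩
        · exact Or.inr ⟨x, hz, rfl⟩
      · rintro (⟨x, hx, rfl⟩ | ⟨x, hx, rfl⟩)
        · exact ⟨_, hx, rfl⟩
        · exact ⟨_, hx, rfl⟩
    rw [this]
    exact (h₁.isClosedMap _ (hC.preimage ha)).union (h₂.isClosedMap _ (hC.preimage hb))
  · have : K ⁻¹' {y} = a '' ((K ∘ a) ⁻¹' {y}) ∪ b '' ((K ∘ b) ⁻¹' {y}) := by
      ext z
      constructor
      · intro hz
        rcases hab z with ⟨x, rfl⟩ | ⟨x, rfl⟩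
        · exact Or.inl ⟨x, hz, rfl⟩
        · exact Or.inr ⟨x, hz, rfl⟩
      · rintro (⟨x, hx, rfl⟩ | ⟨x, hx, rfl⟩)
        · exact hx
        · exact hx
    rw [this]
    exact ((h₁.isCompact_preimage isCompact_singleton).image ha).union
      ((h₂.isCompact_preimage isCompact_singleton).image hb)

theorem ProperlyHomotopic.refl {f : C(X, Y)} (hf : IsProperMap f) : ProperlyHomotopic f f :=
  ⟨ContinuousMap.Homotopy.refl f, hf.comp isProperMap_snd_of_compactSpace⟩

theorem ProperlyHomotopic.symm {f g : C(X, Y)} (h : ProperlyHomotopic f g) :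
    ProperlyHomotopic g f := by
  obtain ⟨H, hH⟩ := h
  exact ⟨H.symm, hH.comp
    ((unitInterval.symmHomeomorph.isProperMap).prodMap (isProperMap_id (X := X)))⟩

theorem ProperlyHomotopic.trans {f g k : C(X, Y)} (h₁ : ProperlyHomotopic f g)
    (h₂ : ProperlyHomotopic g k) : ProperlyHomotopic f k := by
  obtain ⟨F, hF⟩ := h₁
  obtain ⟨G, hG⟩ := h₂
  refine ⟨F.trans G, ?_⟩
  let a : I × X → I × X := fun p =>
    (⟨(p.1 : ℝ) / 2, by have := p.1.2.1; have := p.1.2.2; constructor <;> linarith⟩, p.2)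
  let b : I × X → I × X := fun p =>
    (⟨((p.1 : ℝ) + 1) / 2, by have := p.1.2.1; have := p.1.2.2; constructor <;> linarith⟩, p.2)
  have ha : Continuous a := by fun_prop
  have hb : Continuous b := by fun_prop
  refine isProperMap_of_cover (F.trans G).continuous ha hb ?_ ?_ ?_
  · rintro ⟨⟨t, ht0, ht1⟩, x⟩
    rcases le_total t (1 / 2) with h | h
    · exact Or.inl ⟨(⟨2 * t, by linarith, by linarith⟩, x), by simp [a]⟩
    · exact Or.inr ⟨(⟨2 * t - 1, by linarith, by linarith⟩, x), by simp [b]⟩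
  · convert hF using 1
    funext ⟨⟨t, ht0, ht1⟩, x⟩
    have : t / 2 ≤ 1 / 2 := by linarith
    simp only [Function.comp, a, ContinuousMap.Homotopy.trans_apply]
    rw [dif_pos this]
    congr 3
    ring
  · convert hG using 1
    funext ⟨⟨t, ht0, ht1⟩, x⟩
    simp only [Function.comp, b, ContinuousMap.Homotopy.trans_apply]
    split_ifs with h
    · have : t = 0 := by linarith
      subst this
      have e₁ : (⟨2 * ((0 + 1) / 2), (unitInterval.mul_pos_mem_iff zero_lt_two).2
        ⟨by norm_num, h⟩⟩ : I) = 1 := by ext; norm_num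
      have e₀ : (⟨0, ht0, ht1⟩ : I) = 0 := rfl
      rw [e₁, e₀]
      simp
    · congr 3
      ring

theorem ProperlyHomotopic.comp {f₀ f₁ : C(X, Y)} {g₀ g₁ : C(Y, Z)}
    (hf₀ : IsProperMap f₀) (hg₁ : IsProperMap g₁)
    (hg : ProperlyHomotopic g₀ g₁) (hf : ProperlyHomotopic f₀ f₁) :
    ProperlyHomotopic (g₀.comp f₀) (g₁.comp f₁) := by
  obtain ⟨F, hF⟩ := hf
  obtain ⟨G, hG⟩ := hg
  refine ProperlyHomotopic.trans (g := g₁.comp f₀) ?_ ?_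
  · exact ⟨G.comp (.refl f₀), hG.comp ((isProperMap_id (X := I)).prodMap hf₀)⟩
  · exact ⟨(ContinuousMap.Homotopy.refl g₁).comp F, hg₁.comp hF⟩

variable (X Y) in
/-- Proper continuous maps `X → Y`. -/
def ProperMap : Type (max u v) := {f : C(X, Y) // IsProperMap f}

/-- The identity map, as a proper map. -/
def ProperMap.id : ProperMap X X := ⟨ContinuousMap.id X, isProperMap_id⟩

/-- The composition `g ∘ f` of proper maps. -/
def ProperMap.comp (g : ProperMap Y Z) (f : ProperMap X Y) : ProperMap X Z :=
  ⟨g.1.comp f.1, g.2.comp f.2⟩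

/-- A homeomorphism, as a proper map. -/
def ProperMap.ofHomeomorph (e : X ≃ₜ Y) : ProperMap X Y := ⟨⟨e, e.continuous⟩, e.isProperMap⟩

instance properHomotopySetoid : Setoid (ProperMap X Y) where
  r f g := ProperlyHomotopic f.1 g.1
  iseqv := ⟨fun f => .refl f.2, .symm, .trans⟩

variable (X Y) in
/-- The set of proper homotopy classes of proper maps `X → Y`. -/
def ProperClass : Type (max u v) := Quotient (properHomotopySetoid (X := X) (Y := Y))

/-- The proper homotopy class `[f]` of a proper map `f`. -/
def ProperMap.cls (f : ProperMap X Y) : ProperClass X Y := Quotient.mk _ f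

theorem cls_eq_iff {f g : ProperMap X Y} : f.cls = g.cls ↔ ProperlyHomotopic f.1 g.1 :=
  Quotient.eq

/-- Composition of proper homotopy classes, `[g] [f] = [g ∘ f]`. -/
def ProperClass.comp : ProperClass Y Z → ProperClass X Y → ProperClass X Z :=
  Quotient.map₂ ProperMap.comp fun _ g₁ hg f₀ _ hf =>
    ProperlyHomotopic.comp f₀.2 g₁.2 hg hf

theorem ProperClass.comp_assoc {W : Type*} [TopologicalSpace W] (c : ProperClass Z W)
    (b : ProperClass Y Z) (a : ProperClass X Y) : (c.comp b).comp a = c.comp (b.comp a) := by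
  induction a using Quotient.inductionOn
  induction b using Quotient.inductionOn
  induction c using Quotient.inductionOn
  rfl

theorem ProperClass.id_comp (a : ProperClass X Y) : ProperMap.id.cls.comp a = a := by
  induction a using Quotient.inductionOn
  rfl

theorem ProperClass.comp_id (a : ProperClass X Y) : a.comp ProperMap.id.cls = a := by
  induction a using Quotient.inductionOn
  rfl

/-- Proper homotopy classes of proper self-maps form a monoid under composition. -/
instance : Monoid (ProperClass X X) where
  mul := ProperClass.comp
  one := ProperMap.id.cls
  mul_assoc := ProperClass.comp_assoc
  one_mul := ProperClass.id_comp
  mul_one := ProperClass.comp_id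

variable (X) in
/-- The mapping class group `Maps(X)`: proper homotopy equivalences `X → X` up to proper homotopy.
The class of a proper map `f` is a unit in the monoid of proper homotopy classes exactly if there
is a proper map `g` with `f ∘ g` and `g ∘ f` properly homotopic to the identity. -/
def Maps : Type u := (ProperClass X X)ˣ

instance : Group (Maps X) := inferInstanceAs (Group (ProperClass X X)ˣ)

variable (X Y) in
/-- A proper homotopy equivalence `X → Y` together with a proper homotopy inverse. -/
structure ProperHomotopyEquiv where
  toMap : ProperMap X Y
  invMap : ProperMap Y X
  inv_comp : ProperlyHomotopic (invMap.comp toMap).1 (ContinuousMap.id X)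
  comp_inv : ProperlyHomotopic (toMap.comp invMap).1 (ContinuousMap.id Y)

theorem ProperHomotopyEquiv.inv_comp_cls (e : ProperHomotopyEquiv X Y) :
    e.invMap.cls.comp e.toMap.cls = ProperMap.id.cls :=
  Quotient.sound e.inv_comp

theorem ProperHomotopyEquiv.comp_inv_cls (e : ProperHomotopyEquiv X Y) :
    e.toMap.cls.comp e.invMap.cls = ProperMap.id.cls :=
  Quotient.sound e.comp_inv

/-- The element of `Maps(X)` represented by a proper homotopy equivalence `X → X`. -/
def ProperHomotopyEquiv.toMaps (e : ProperHomotopyEquiv X X) : Maps X :=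
  Units.mk e.toMap.cls e.invMap.cls e.comp_inv_cls e.inv_comp_cls

/-- The isomorphism `Maps(X) ≃ Maps(Y)`, `[f] ↦ [F ∘ f ∘ F']`, induced by a proper homotopy
equivalence `F : X → Y` with proper homotopy inverse `F' : Y → X`. -/
def mapsCongr (e : ProperHomotopyEquiv X Y) : Maps X ≃* Maps Y :=
  Units.mapEquiv
    { toFun := fun c => (e.toMap.cls.comp c).comp e.invMap.cls
      invFun := fun c => (e.invMap.cls.comp c).comp e.toMap.cls
      left_inv := fun c => by
        beta_reduce
        rw [ProperClass.comp_assoc, ProperClass.comp_assoc, ProperClass.comp_assoc,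
          e.inv_comp_cls, ProperClass.comp_id, ← ProperClass.comp_assoc, e.inv_comp_cls,
          ProperClass.id_comp]
      right_inv := fun c => by
        beta_reduce
        rw [ProperClass.comp_assoc, ProperClass.comp_assoc, ProperClass.comp_assoc,
          e.comp_inv_cls, ProperClass.comp_id, ← ProperClass.comp_assoc, e.comp_inv_cls,
          ProperClass.id_comp]
      map_mul' := fun c d => by
        change (e.toMap.cls.comp (c.comp d)).comp e.invMap.cls =
          ((e.toMap.cls.comp c).comp e.invMap.cls).comp ((e.toMap.cls.comp d).comp e.invMap.cls)
        simp only [ProperClass.comp_assoc]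
        rw [← ProperClass.comp_assoc e.invMap.cls e.toMap.cls, e.inv_comp_cls,
          ProperClass.id_comp] }

end ProperHomotopy

/-! ## Ends, the end compactification and the topology of the mapping class group -/

section Ends

variable (X : Type u) [TopologicalSpace X]

/-- An end of `X`, i.e. an element of the inverse limit over the compact sets `K ⊆ X` of the sets
of connected components of `X \ K`. A component is encoded as the corresponding subset of `X`; it
is mapped to the component of a larger complement in which it is contained. -/
@[ext]
structure Ends where
  comp : Compacts X → Set X
  isComponent : ∀ K : Compacts X, ∃ x ∈ (K : Set X)ᶜ, comp K = connectedComponentIn (K : Set X)ᶜ x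
  compatible : ∀ K L : Compacts X, K ≤ L → comp L ⊆ comp K

/-- The underlying set `X ⊔ ∂X` of the end (Freudenthal) compactification of `X`. -/
def EndCompactification : Type u := X ⊕ Ends X

variable {X}

/-- A point of `X`, viewed in the end compactification. -/
def EndCompactification.ofPoint (x : X) : EndCompactification X := Sum.inl x

/-- An end of `X`, viewed in the end compactification. -/
def EndCompactification.ofEnd (e : Ends X) : EndCompactification X := Sum.inr e

/-- For `K ⊆ X` compact and `U ⊆ X`, the union of `U` and the set of all ends whose component of
`X \ K` is `U`. -/
def EndCompactification.hat (K : Compacts X) (U : Set X) : Set (EndCompactification X) :=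
  ofPoint '' U ∪ ofEnd '' {e : Ends X | e.comp K = U}

/-- The topology of the end compactification, generated by the open subsets of `X` and the sets
`hat K U` where `K ⊆ X` is compact and `U` is a component of `X \ K`. -/
instance : TopologicalSpace (EndCompactification X) :=
  generateFrom
    ({S | ∃ U : Set X, IsOpen U ∧ S = EndCompactification.ofPoint '' U} ∪
      {S | ∃ K : Compacts X, ∃ x ∈ (K : Set X)ᶜ,
        S = EndCompactification.hat K (connectedComponentIn (K : Set X)ᶜ x)})

variable (X) in
/-- The space `PH(X)` of pairs of mutually inverse proper homotopy equivalences of `X`, each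
extended continuously to the end compactification. (The maps `f` and `g` are determined by their
extensions.) -/
structure PH extends ProperHomotopyEquiv X X where
  toHat : C(EndCompactification X, EndCompactification X)
  invHat : C(EndCompactification X, EndCompactification X)
  toHat_ofPoint : ∀ x : X, toHat (.ofPoint x) = .ofPoint (toMap.1 x)
  invHat_ofPoint : ∀ x : X, invHat (.ofPoint x) = .ofPoint (invMap.1 x)

/-- `PH(X)` carries the topology induced from the product of two copies of the space of continuous
self-maps of the end compactification, with the compact-open topology. -/
instance : TopologicalSpace (PH X) :=
  TopologicalSpace.induced (fun p => (p.toHat, p.invHat)) inferInstance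

/-- `Maps(X)` carries the quotient topology under the map from `PH(X)` that takes a pair to the
proper homotopy class of its first entry. -/
instance : TopologicalSpace (Maps X) :=
  TopologicalSpace.coinduced (fun p : PH X => p.toProperHomotopyEquiv.toMaps) inferInstance

end Ends

/-! ## Geometric realizations of graphs -/

section Realization

variable {V : Type u} {W : Type v}

open Classical in
/-- The geometric realization `|G|` of a simple graph, in barycentric coordinates: the union in
`V → ℝ` of all vertices `δ_v` and of the segments `[δ_v, δ_w]` for all edges `vw`. The topology is
that of pointwise convergence of the coordinates; for locally finite graphs this is the usual
topology of `|G|` as a one-dimensional CW complex. -/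
def Realization (G : SimpleGraph V) : Type u :=
  {x : V → ℝ // (∃ v, x = Pi.single v 1) ∨
    ∃ v w, G.Adj v w ∧ x ∈ segment ℝ (Pi.single v 1 : V → ℝ) (Pi.single w 1)}

instance (G : SimpleGraph V) : TopologicalSpace (Realization G) :=
  instTopologicalSpaceSubtype

theorem single_comp_symm [DecidableEq V] [DecidableEq W] (e : V ≃ W) (v : V) :
    (Pi.single v 1 : V → ℝ) ∘ e.symm = Pi.single (e v) 1 := by
  funext w
  simp [Pi.single_apply, Equiv.symm_apply_eq]

/-- The map of realizations induced by an isomorphism of graphs: it takes vertices to vertices as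
the given isomorphism does, and is affine on edges. -/
def realizationMap {G : SimpleGraph V} {G' : SimpleGraph W} (φ : G ≃g G') (x : Realization G) :
    Realization G' :=
  ⟨x.1 ∘ φ.symm, by
    classical
    obtain ⟨x, ⟨v, rfl⟩ | ⟨v, w, hvw, a, b, ha, hb, hab, rfl⟩⟩ := x
    · exact Or.inl ⟨φ v, by convert single_comp_symm φ.toEquiv v <;> rfl⟩
    · refine Or.inr ⟨φ v, φ w, φ.map_adj_iff.2 hvw, a, b, ha, hb, hab, ?_⟩
      have hv := single_comp_symm φ.toEquiv v
      have hw := single_comp_symm φ.toEquiv w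
      funext z
      have hv' := congrFun hv z
      have hw' := congrFun hw z
      simp only [Function.comp_apply, Pi.add_apply, Pi.smul_apply] at hv' hw' ⊢
      convert congrArg₂ (fun s t => a • s + b • t) hv'.symm hw'.symm <;> rfl⟩

theorem continuous_realizationMap {G : SimpleGraph V} {G' : SimpleGraph W} (φ : G ≃g G') :
    Continuous (realizationMap φ) :=
  Continuous.subtype_mk (f := fun x : Realization G => x.1 ∘ φ.symm)
    (continuous_pi fun w => (continuous_apply (φ.symm w)).comp
      (continuous_subtype_val : Continuous fun x : Realization G => x.1)) _

/-- The homeomorphism of realizations induced by an isomorphism of graphs. -/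
def realizationHomeomorph {G : SimpleGraph V} {G' : SimpleGraph W} (φ : G ≃g G') :
    Realization G ≃ₜ Realization G' where
  toFun := realizationMap φ
  invFun := realizationMap φ.symm
  left_inv x := Subtype.ext <| funext fun v => congrArg x.1 (φ.symm_apply_apply v)
  right_inv x := Subtype.ext <| funext fun v => congrArg x.1 (φ.apply_symm_apply v)
  continuous_toFun := continuous_realizationMap φ
  continuous_invFun := continuous_realizationMap φ.symm

/-- The homomorphism `Aut(G) → Maps(|G|)` which takes a simplicial automorphism to the class of the
homeomorphism of `|G|` that it induces. -/
def autToMaps (G : SimpleGraph V) : (G ≃g G) →* Maps (Realization G) where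
  toFun φ := Units.mk (ProperMap.ofHomeomorph (realizationHomeomorph φ)).cls
    (ProperMap.ofHomeomorph (realizationHomeomorph φ.symm)).cls
    (congrArg ProperMap.cls <| Subtype.ext <| ContinuousMap.ext fun x =>
      (realizationHomeomorph φ).apply_symm_apply x)
    (congrArg ProperMap.cls <| Subtype.ext <| ContinuousMap.ext fun x =>
      (realizationHomeomorph φ).symm_apply_apply x)
  map_one' := rfl
  map_mul' _ _ := rfl

end Realization

end GraphMaps

/-!
A proper map between locally finite trees is determined up to proper homotopy by the map it induces
on the spaces of ends: if two proper maps agree on the ends, then far out their values lie in the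
same branches, and moving each value along the geodesic to the last common point is a proper
homotopy (`Rooting.properlyHomotopic_of_endMap_eq`). Hence a mapping class is known once its action
on the ends is known, and it suffices to find a tree `Y` with an action of `H`, and a proper homotopy
equivalence to `Y` that is equivariant on the ends.

Root the tree, and describe an end by the vertices `lev e n` of depth `n` on the ray that converges
to it. The action of a mapping class `h` on the ends, seen up to depth `n`, is the function
`e ↦ lev (h • e) n`; it is a locally constant function of `h`, because the space of ends is compact
and the compact-open topology controls the images of its clopen subsets
(`Rooting.isOpen_setOf_lev_smul_eq`). As `H` is compact, only finitely many such functions occur for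
`h ∈ H` (`Rooting.finite_lev_smul`). So the relation `lev (h • e) n = lev (h • e') n` for all `h ∈ H`
defines a finite `H`-invariant partition of the ends into clopen sets; it gets finer as `n` grows,
and separates all ends in the limit (`Rooting.orbitPartition`).

The classes of these partitions are the vertices of `Y`, each class being joined to the class of the
previous partition that contains it, and `H` acts on `Y` by its action on the ends. Simplicial maps
with finite fibres between the two trees give the proper homotopy equivalence: from `Y`, a class of
the `n`-th partition goes to the vertex of depth `n` beyond which its ends lie; to `Y`, a vertex
goes to a class that contains all ends beyond it, chosen so that the depth increases by at most one
along each edge (`Rooting.EndPartition.properHomotopyEquiv`). Both maps induce the canonical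
bijection on the ends, which is equivariant (`Rooting.EndPartition.endMap_graphIso`).

Maps into a rooted tree are handled in ancestor coordinates (`Rooting.co`): the coordinate of a
point at a vertex `w` is the part of the edge from the parent of `w` to `w` that is covered by the
path from the root to the point. In these coordinates, last common points are pointwise minima.
-/


namespace GraphMaps

open Set Topology TopologicalSpace Filter
open scoped unitInterval

/-! ### The action of proper maps on ends -/

section EndMaps

variable {X : Type u} {Y : Type v} {Z : Type w}
  [TopologicalSpace X] [TopologicalSpace Y] [TopologicalSpace Z]

namespace Ends

theorem comp_nonempty (e : Ends X) (K : Compacts X) : (e.comp K).Nonempty := by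
  obtain ⟨x, hx, h⟩ := e.isComponent K
  exact ⟨x, h ▸ mem_connectedComponentIn hx⟩

theorem comp_subset (e : Ends X) (K : Compacts X) : e.comp K ⊆ (K : Set X)ᶜ := by
  obtain ⟨x, hx, h⟩ := e.isComponent K
  exact h ▸ connectedComponentIn_subset _ _

theorem isPreconnected_comp (e : Ends X) (K : Compacts X) : IsPreconnected (e.comp K) := by
  obtain ⟨x, hx, h⟩ := e.isComponent K
  exact h ▸ isPreconnected_connectedComponentIn

theorem comp_eq_of_mem (e : Ends X) {K : Compacts X} {x : X} (hx : x ∈ e.comp K) :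
    e.comp K = connectedComponentIn (K : Set X)ᶜ x := by
  obtain ⟨y, hy, h⟩ := e.isComponent K
  rw [h] at hx ⊢
  exact connectedComponentIn_eq hx

theorem subset_comp (e : Ends X) {K : Compacts X} {S : Set X} (hS : IsPreconnected S)
    (hSK : S ⊆ (K : Set X)ᶜ) {x : X} (hx : x ∈ S) (hxe : x ∈ e.comp K) : S ⊆ e.comp K := by
  rw [e.comp_eq_of_mem hxe]
  exact hS.subset_connectedComponentIn hx hSK

theorem comp_eq_comp (e e' : Ends X) {K : Compacts X} {x : X} (hx : x ∈ e.comp K)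
    (hx' : x ∈ e'.comp K) : e.comp K = e'.comp K := by
  rw [e.comp_eq_of_mem hx, e'.comp_eq_of_mem hx']

end Ends

/-- The preimage of a compact set under a proper map. -/
def ProperMap.preimage (f : ProperMap X Y) (K : Compacts Y) : Compacts X :=
  ⟨f.1 ⁻¹' K, f.2.isCompact_preimage K.isCompact⟩

/-- The map of ends induced by a proper map `f`: the component of `Y \ K` chosen by the image of
an end `e` is the one that contains the image of the component of `X \ f⁻¹(K)` chosen by `e`. -/
noncomputable def ProperMap.endMap (f : ProperMap X Y) (e : Ends X) : Ends Y where
  comp K := connectedComponentIn (K : Set Y)ᶜ (f.1 (e.comp_nonempty (f.preimage K)).some)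
  isComponent K :=
    ⟨_, e.comp_subset (f.preimage K) (e.comp_nonempty (f.preimage K)).some_mem, rfl⟩
  compatible K L hKL := by
    set x := (e.comp_nonempty (f.preimage K)).some with hx
    set y := (e.comp_nonempty (f.preimage L)).some with hy
    have hxK : x ∈ e.comp (f.preimage K) := (e.comp_nonempty (f.preimage K)).some_mem
    have hyL : y ∈ e.comp (f.preimage L) := (e.comp_nonempty (f.preimage L)).some_mem
    have hyK : y ∈ e.comp (f.preimage K) :=
      e.compatible (f.preimage K) (f.preimage L) (fun z hz => hKL hz) hyL
    have h : f.1 y ∈ connectedComponentIn (K : Set Y)ᶜ (f.1 x) :=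
      ((e.isPreconnected_comp (f.preimage K)).image f.1
        f.1.continuous.continuousOn).subset_connectedComponentIn (mem_image_of_mem _ hxK)
        (by rintro _ ⟨z, hz, rfl⟩; exact e.comp_subset _ hz) (mem_image_of_mem _ hyK)
    rw [connectedComponentIn_eq h]
    exact connectedComponentIn_mono _ (compl_subset_compl.2 hKL)

theorem ProperMap.mapsTo_endMap (f : ProperMap X Y) (e : Ends X) {K : Compacts Y}
    {L : Compacts X} (hL : f.preimage K ≤ L) : MapsTo f.1 (e.comp L) ((f.endMap e).comp K) := by
  have h : f.1 '' e.comp (f.preimage K) ⊆ (f.endMap e).comp K :=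
    ((e.isPreconnected_comp (f.preimage K)).image f.1
      f.1.continuous.continuousOn).subset_connectedComponentIn
      (mem_image_of_mem _ (e.comp_nonempty (f.preimage K)).some_mem)
      (by rintro _ ⟨z, hz, rfl⟩; exact e.comp_subset _ hz)
  exact fun x hx => h (mem_image_of_mem _ (e.compatible _ _ hL hx))

theorem ProperMap.endMap_eq_of_properlyHomotopic {f g : ProperMap X Y}
    (h : ProperlyHomotopic f.1 g.1) (e : Ends X) : f.endMap e = g.endMap e := by
  obtain ⟨F, hF⟩ := h
  refine Ends.ext (funext fun K => ?_)
  -- outside the projection `L` of `F⁻¹(K)`, the whole track of the homotopy avoids `K`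
  let L : Compacts X := ⟨Prod.snd '' (F ⁻¹' K), (hF.isCompact_preimage K.isCompact).image
    continuous_snd⟩
  have hf : f.preimage K ≤ L := fun x hx => ⟨(0, x), by
    rw [mem_preimage, F.apply_zero]; exact hx, rfl⟩
  have hg : g.preimage K ≤ L := fun x hx => ⟨(1, x), by
    rw [mem_preimage, F.apply_one]; exact hx, rfl⟩
  obtain ⟨x, hx⟩ := e.comp_nonempty L
  have hxL : x ∉ (L : Set X) := e.comp_subset L hx
  have hS : IsPreconnected (range fun t : I => F (t, x)) :=
    isPreconnected_range (by fun_prop)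
  have hSK : (range fun t : I => F (t, x)) ⊆ (K : Set Y)ᶜ := by
    rintro _ ⟨t, rfl⟩ ht
    exact hxL ⟨(t, x), ht, rfl⟩
  refine Ends.comp_eq_comp _ _ (x := g.1 x) ?_ (g.mapsTo_endMap e hg hx)
  exact (f.endMap e).subset_comp hS hSK ⟨0, F.apply_zero x⟩ (f.mapsTo_endMap e hf hx)
    ⟨1, F.apply_one x⟩

theorem ProperMap.endMap_id (e : Ends X) : (ProperMap.id : ProperMap X X).endMap e = e := by
  refine Ends.ext (funext fun K => ?_)
  obtain ⟨x, hx⟩ := e.comp_nonempty K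
  exact Ends.comp_eq_comp _ _ (ProperMap.id.mapsTo_endMap e (fun _ h => h) hx) hx

theorem ProperMap.endMap_comp (g : ProperMap Y Z) (f : ProperMap X Y) (e : Ends X) :
    (g.comp f).endMap e = g.endMap (f.endMap e) := by
  refine Ends.ext (funext fun K => ?_)
  obtain ⟨x, hx⟩ := e.comp_nonempty (f.preimage (g.preimage K))
  exact Ends.comp_eq_comp _ _ ((g.comp f).mapsTo_endMap e (fun _ h => h) hx)
    (g.mapsTo_endMap _ (fun _ h => h) (f.mapsTo_endMap e (fun _ h => h) hx))

/-- The map of ends induced by a proper homotopy class. -/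
noncomputable def ProperClass.endMap (c : ProperClass X Y) (e : Ends X) : Ends Y :=
  Quotient.lift (fun f : ProperMap X Y => f.endMap e)
    (fun _ _ h => ProperMap.endMap_eq_of_properlyHomotopic h e) c

theorem ProperClass.endMap_comp (c : ProperClass Y Z) (d : ProperClass X Y) (e : Ends X) :
    (c.comp d).endMap e = c.endMap (d.endMap e) := by
  induction c using Quotient.inductionOn
  induction d using Quotient.inductionOn
  exact ProperMap.endMap_comp _ _ e

/-- The mapping class group acts on the space of ends. -/
noncomputable instance : MulAction (Maps X) (Ends X) where
  smul h e := ProperClass.endMap (Units.val h : ProperClass X X) e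
  one_smul e := ProperMap.endMap_id e
  mul_smul h k e := ProperClass.endMap_comp (Units.val h) (Units.val k) e

theorem Maps.smul_def (h : Maps X) (e : Ends X) :
    h • e = ProperClass.endMap (Units.val h : ProperClass X X) e := rfl

end EndMaps

/-! ### Rooted trees and their ancestor order -/

open scoped Classical

variable {V : Type u} {W : Type v}

/-- A graph `G` presented as a rooted tree with finite levels: each vertex `v` other than the root
is joined to its parent, one level below, and there are no other edges. The parent of the root is
the root itself, as `depth_parent` forces. -/
structure Rooting (G : SimpleGraph V) where
  root : V
  parent : V → V
  depth : V → ℕ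
  depth_eq_zero_iff : ∀ v, depth v = 0 ↔ v = root
  depth_parent : ∀ v, depth (parent v) = depth v - 1
  adj_iff : ∀ v w, G.Adj v w ↔ (v ≠ root ∧ parent v = w) ∨ (w ≠ root ∧ parent w = v)
  finite_level : ∀ n, {v | depth v = n}.Finite

namespace Rooting

section Combinatorics

variable {G : SimpleGraph V} (R : Rooting G)

theorem depth_root : R.depth R.root = 0 := (R.depth_eq_zero_iff _).2 rfl

theorem parent_root : R.parent R.root = R.root := by
  rw [← R.depth_eq_zero_iff, R.depth_parent, R.depth_root]

theorem ne_root_iff {v : V} : v ≠ R.root ↔ 0 < R.depth v := by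
  rw [Ne, ← R.depth_eq_zero_iff, Nat.pos_iff_ne_zero]

theorem finite_depth_lt (n : ℕ) : {v | R.depth v < n}.Finite := by
  refine ((Set.finite_lt_nat n).biUnion (t := fun k => {v | R.depth v = k})
    fun k _ => R.finite_level k).subset fun v hv => ?_
  simpa using hv

/-- The ancestor of `v` of depth `n`; it is `v` itself if `n` is at least the depth of `v`. -/
def anc (v : V) (n : ℕ) : V := R.parent^[R.depth v - n] v

theorem anc_of_le {v : V} {n : ℕ} (h : R.depth v ≤ n) : R.anc v n = v := by
  simp [anc, Nat.sub_eq_zero_of_le h]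

theorem anc_self (v : V) : R.anc v (R.depth v) = v := R.anc_of_le le_rfl

theorem depth_iterate (v : V) (k : ℕ) : R.depth (R.parent^[k] v) = R.depth v - k := by
  induction k with
  | zero => rfl
  | succ k ih => rw [Function.iterate_succ_apply', R.depth_parent, ih]; omega

theorem depth_anc (v : V) (n : ℕ) : R.depth (R.anc v n) = min n (R.depth v) := by
  rw [anc, depth_iterate]; omega

theorem anc_anc (v : V) {m n : ℕ} (h : m ≤ n) : R.anc (R.anc v n) m = R.anc v m := by
  rcases le_total (R.depth v) n with hn | hn
  · rw [R.anc_of_le hn]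
  · rw [anc, R.depth_anc, min_eq_left hn, anc, ← Function.iterate_add_apply, anc]
    congr 1
    omega

theorem parent_anc {v : V} {n : ℕ} (h : n < R.depth v) :
    R.parent (R.anc v (n + 1)) = R.anc v n := by
  rw [anc, ← Function.iterate_succ_apply' R.parent, anc]
  congr 1
  omega

theorem anc_parent {v : V} {n : ℕ} (h : n < R.depth v) : R.anc (R.parent v) n = R.anc v n := by
  rw [anc, ← Function.iterate_succ_apply, R.depth_parent, anc]
  congr 1
  omega

theorem anc_depth_sub_one (v : V) : R.anc v (R.depth v - 1) = R.parent v := by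
  rcases Nat.eq_zero_or_pos (R.depth v) with h | h
  · rw [R.anc_of_le (by omega), (R.depth_eq_zero_iff v).1 h, R.parent_root]
  · rw [← R.anc_parent (by omega), ← R.depth_parent, R.anc_self]

/-- `w` lies on the branch from the root to `v`. -/
def IsAnc (w v : V) : Prop := R.anc v (R.depth w) = w

theorem IsAnc.depth_le {R : Rooting G} {w v : V} (h : R.IsAnc w v) : R.depth w ≤ R.depth v := by
  have := congrArg R.depth h
  rw [R.depth_anc] at this
  omega

theorem isAnc_refl (v : V) : R.IsAnc v v := R.anc_self v

theorem isAnc_anc (v : V) (n : ℕ) : R.IsAnc (R.anc v n) v := by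
  rcases le_total (R.depth v) n with hn | hn
  · rw [R.anc_of_le hn]; exact R.isAnc_refl v
  · rw [IsAnc, R.depth_anc, min_eq_left hn]

theorem isAnc_parent (v : V) : R.IsAnc (R.parent v) v := by
  rw [← R.anc_depth_sub_one v]; exact R.isAnc_anc _ _

theorem isAnc_root (v : V) : R.IsAnc R.root v := by
  rw [IsAnc, R.depth_root, ← R.depth_eq_zero_iff, R.depth_anc]; simp

theorem IsAnc.trans {R : Rooting G} {u w v : V} (h₁ : R.IsAnc u w) (h₂ : R.IsAnc w v) :
    R.IsAnc u v := by
  rw [IsAnc, ← R.anc_anc v h₁.depth_le, h₂, h₁]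

theorem IsAnc.eq_of_depth_eq {R : Rooting G} {u w v : V} (h₁ : R.IsAnc u v) (h₂ : R.IsAnc w v)
    (h : R.depth u = R.depth w) : u = w := by
  rw [← h₁, ← h₂, h]

theorem isAnc_parent_iff {u v : V} (hv : v ≠ R.root) :
    R.IsAnc u (R.parent v) ↔ R.IsAnc u v ∧ u ≠ v := by
  have hd := R.ne_root_iff.1 hv
  constructor
  · refine fun h => ⟨h.trans (R.isAnc_parent v), ?_⟩
    rintro rfl
    have := h.depth_le
    rw [R.depth_parent] at this
    omega
  · rintro ⟨h, hne⟩
    have hlt : R.depth u < R.depth v := lt_of_le_of_ne h.depth_le fun hd' =>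
      hne (h.eq_of_depth_eq (R.isAnc_refl v) hd')
    rw [IsAnc, R.anc_parent hlt, h]

/-- The children of a vertex. -/
noncomputable def children (v : V) : Finset V :=
  ((R.finite_level (R.depth v + 1)).subset
    (t := {c | c ≠ R.root ∧ R.parent c = v}) (by
      rintro c ⟨hc, rfl⟩
      have := R.ne_root_iff.1 hc
      simp only [mem_ofPred_eq, R.depth_parent]
      omega)).toFinset

theorem mem_children {c v : V} : c ∈ R.children v ↔ c ≠ R.root ∧ R.parent c = v := by
  simp [children]

theorem adj_parent {v : V} (hv : v ≠ R.root) : G.Adj (R.parent v) v :=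
  (R.adj_iff _ _).2 (Or.inr ⟨hv, rfl⟩)

theorem isTree (R : Rooting G) : G.IsTree := by
  refine ⟨{ preconnected := ?_, nonempty := ⟨R.root⟩ }, ?_⟩
  · have key : ∀ n v, R.depth v = n → G.Reachable R.root v := by
      intro n
      induction n with
      | zero => intro v hv; rw [(R.depth_eq_zero_iff v).1 hv]
      | succ n ih =>
        intro v hv
        exact (ih (R.parent v) (by rw [R.depth_parent]; omega)).trans
          (R.adj_parent (R.ne_root_iff.2 (by omega))).reachable
    intro v w
    exact (key _ v rfl).symm.trans (key _ w rfl)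
  · rw [SimpleGraph.isAcyclic_iff_forall_adj_isBridge]
    -- removing the edge from `v` to its parent isolates the descendants of `v`
    have key : ∀ v, v ≠ R.root → G.IsBridge s(R.parent v, v) := by
      intro v hv
      rw [SimpleGraph.isBridge_iff]
      have hstep : ∀ x y, R.IsAnc v x → (G \ SimpleGraph.fromEdgeSet {s(R.parent v, v)}).Adj x y →
          R.IsAnc v y := by
        intro x y hx hxy
        obtain ⟨hG, hne⟩ := hxy
        rcases (R.adj_iff x y).1 hG with ⟨hr, rfl⟩ | ⟨hr, rfl⟩
        · refine (R.isAnc_parent_iff hr).2 ⟨hx, ?_⟩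
          rintro rfl
          exact hne (by simp [Sym2.eq_swap, hG.ne])
        · exact hx.trans (R.isAnc_parent y)
      rintro ⟨p⟩
      have hwalk : ∀ x y, (G \ SimpleGraph.fromEdgeSet {s(R.parent v, v)}).Walk x y →
          R.IsAnc v x → R.IsAnc v y := by
        intro x y q
        induction q with
        | nil => exact id
        | cons h _ ih => exact fun hx => ih (hstep _ _ hx h)
      have := (hwalk _ _ p.reverse (R.isAnc_refl v)).depth_le
      rw [R.depth_parent] at this
      have := R.ne_root_iff.1 hv
      omega
    intro v w hvw
    rcases (R.adj_iff v w).1 hvw with ⟨hr, rfl⟩ | ⟨hr, rfl⟩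
    · rw [Sym2.eq_swap]; exact key v hr
    · exact key w hr

theorem finite_neighborSet (R : Rooting G) (v : V) : (G.neighborSet v).Finite := by
  refine ((finite_singleton (R.parent v)).union (R.children v).finite_toSet).subset ?_
  intro w hw
  rcases (R.adj_iff v w).1 hw with ⟨_, rfl⟩ | h
  · exact Or.inl rfl
  · exact Or.inr (by simpa [mem_children] using h)

end Combinatorics

/-- A locally finite tree can be rooted at any vertex. -/
theorem exists_of_isTree {G : SimpleGraph V} (hG : G.IsTree)
    (hfin : ∀ v, (G.neighborSet v).Finite) (r : V) : ∃ R : Rooting G, R.root = r := by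
  have hconn := hG.connected
  have hpos : ∀ v, v ≠ r → G.dist r v ≠ 0 := fun v hv h => hv (hconn.dist_eq_zero_iff.1 h).symm
  have hex : ∀ v, ∃ p, (v ≠ r → G.Adj p v ∧ G.dist r p + 1 = G.dist r v) ∧ (v = r → p = r) := by
    intro v
    by_cases hv : v = r
    · exact ⟨r, fun h => (h hv).elim, fun _ => rfl⟩
    · obtain ⟨p, hp, hlen⟩ := hconn.exists_path_of_dist r v
      have hnil : ¬ p.Nil := fun h => hv h.eq.symm
      have hadj := p.adj_penultimate hnil
      refine ⟨p.penultimate, fun _ => ⟨hadj, ?_⟩, fun h => (hv h).elim⟩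
      have h₁ : G.dist r p.penultimate ≤ p.dropLast.length := SimpleGraph.dist_le _
      have h₂ := hG.dist_eq_dist_add_one_of_adj r hadj
      have h₃ := p.length_dropLast_add_one hnil
      omega
  choose par hpar hparr using hex
  -- two neighbours of `v` closer to the root are joined to the root by paths that avoid `v`
  have huniq : ∀ v p, G.Adj p v → G.dist r p + 1 = G.dist r v → p = par v := by
    intro v p hp hd
    have hv : v ≠ r := by rintro rfl; simp at hd
    obtain ⟨hq, hdq⟩ := hpar v hv
    have aux : ∀ p, G.Adj p v → G.dist r p + 1 = G.dist r v →
        ∃ P : G.Walk r v, P.IsPath ∧ P.penultimate = p := by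
      intro p hp hd
      obtain ⟨P, hP, hlen⟩ := hconn.exists_path_of_dist r p
      refine ⟨P.concat hp, ?_, by simp⟩
      refine hP.concat (fun hmem => ?_) hp
      have h₁ : G.dist r v ≤ (P.takeUntil v hmem).length := SimpleGraph.dist_le _
      have h₂ := P.length_takeUntil_le_length hmem
      omega
    obtain ⟨P, hP, rfl⟩ := aux p hp hd
    obtain ⟨Q, hQ, hQ'⟩ := aux _ hq hdq
    rw [← hQ', (hG.existsUnique_path r v).unique hP hQ]
  refine ⟨⟨r, par, fun v => G.dist r v, fun v => ?_, fun v => ?_, fun v w => ?_, fun n => ?_⟩, rfl⟩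
  · rw [hconn.dist_eq_zero_iff]; exact eq_comm
  · by_cases hv : v = r
    · rw [hparr v hv, hv]; simp
    · have := (hpar v hv).2; omega
  · constructor
    · intro h
      rcases hG.dist_eq_dist_add_one_of_adj r h with hd | hd
      · exact Or.inl ⟨fun hv => by subst hv; simp at hd, (huniq v w h.symm hd.symm).symm⟩
      · exact Or.inr ⟨fun hv => by subst hv; simp at hd, (huniq w v h hd.symm).symm⟩
    · rintro (⟨hv, rfl⟩ | ⟨hw, rfl⟩)
      · exact (hpar v hv).1.symm
      · exact (hpar w hw).1
  · induction n with
    | zero =>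
      refine (finite_singleton r).subset fun v hv => ?_
      exact (hconn.dist_eq_zero_iff.1 hv).symm
    | succ n ih =>
      refine (ih.biUnion (t := fun v => G.neighborSet v) fun v _ => hfin v).subset fun v hv => ?_
      have hv' : G.dist r v = n + 1 := hv
      have hvr : v ≠ r := by rintro rfl; simp at hv'
      obtain ⟨ha, hd⟩ := hpar v hvr
      exact mem_biUnion (x := par v) (show G.dist r (par v) = n by omega) ha

end Rooting

/-! ### Ancestor coordinates on the realization of a rooted tree -/

instance (G : SimpleGraph V) : T2Space (Realization G) :=
  inferInstanceAs (T2Space {_x : V → ℝ // _})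

/-- A vertex, as a point of the realization. -/
noncomputable def Realization.vert (G : SimpleGraph V) (v : V) : Realization G :=
  ⟨Pi.single v 1, Or.inl ⟨v, rfl⟩⟩

namespace Rooting

variable {G : SimpleGraph V} (R : Rooting G)

/-- The point that divides the edge from the parent of `w` to `w` in the ratio `t : 1 - t`. For
the root, whose parent is itself, this is the root for all `t`. -/
noncomputable def pt (w : V) (t : I) : Realization G :=
  ⟨(1 - (t : ℝ)) • Pi.single (R.parent w) 1 + (t : ℝ) • Pi.single w 1, by
    by_cases hw : w = R.root
    · refine Or.inl ⟨w, ?_⟩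
      rw [hw, R.parent_root, ← add_smul]
      simp
    · exact Or.inr ⟨_, _, R.adj_parent hw, _, _, sub_nonneg.2 t.2.2, t.2.1, by ring, rfl⟩⟩

theorem pt_apply (w : V) (t : I) (v : V) : (R.pt w t).1 v =
    (if v = R.parent w then 1 - (t : ℝ) else 0) + (if v = w then (t : ℝ) else 0) := by
  simp [pt, Pi.single_apply]

theorem pt_one (w : V) : R.pt w 1 = Realization.vert G w := by
  refine Subtype.ext (funext fun v => ?_)
  simp [pt, Realization.vert]

theorem continuous_pt (w : V) : Continuous (R.pt w) :=
  Continuous.subtype_mk (by fun_prop) _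

theorem exists_eq_pt (x : Realization G) : ∃ w, ∃ t : I, 0 < (t : ℝ) ∧ x = R.pt w t := by
  have hvert : ∀ v, ∃ w, ∃ t : I, 0 < (t : ℝ) ∧ Realization.vert G v = R.pt w t :=
    fun v => ⟨v, 1, by simp, (R.pt_one v).symm⟩
  have key : ∀ w, w ≠ R.root → ∀ a b : ℝ, 0 ≤ a → 0 ≤ b → a + b = 1 →
      x.1 = a • (Pi.single (R.parent w) 1 : V → ℝ) + b • (Pi.single w 1 : V → ℝ) →
      ∃ w, ∃ t : I, 0 < (t : ℝ) ∧ x = R.pt w t := by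
    intro w hw a b ha hb hab hx
    rcases hb.eq_or_lt with h0 | h0
    · obtain ⟨w', t, ht, h⟩ := hvert (R.parent w)
      refine ⟨w', t, ht, h ▸ Subtype.ext ?_⟩
      rw [hx, ← h0, show a = 1 by linarith]
      simp [Realization.vert]
    · refine ⟨w, ⟨b, hb, by linarith⟩, h0, Subtype.ext ?_⟩
      obtain rfl : a = 1 - b := by linarith
      exact hx
  obtain ⟨v, hv⟩ | ⟨v, w, hvw, a, b, ha, hb, hab, hx⟩ := x.2
  · obtain ⟨w, t, ht, h⟩ := hvert v
    exact ⟨w, t, ht, h ▸ Subtype.ext hv⟩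
  · rcases (R.adj_iff v w).1 hvw with ⟨hr, rfl⟩ | ⟨hr, rfl⟩
    · exact key v hr b a hb ha (by linarith) (by rw [← hx, add_comm])
    · exact key w hr a b ha hb hab hx.symm

/-- The coordinate of a point `x` at a vertex `w`: the sum of the barycentric coordinates of `x` at
the descendants of `w`. Geometrically, it is the part of the edge from the parent of `w` to `w` that
lies on the path from the root to `x`. -/
noncomputable def co (x : Realization G) (w : V) : ℝ :=
  ∑ᶠ v, if R.IsAnc w v then x.1 v else 0

theorem co_eq_sum {x : Realization G} {s : Finset V} (hs : ∀ v, x.1 v ≠ 0 → v ∈ s) (w : V) :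
    R.co x w = ∑ v ∈ s, if R.IsAnc w v then x.1 v else 0 := by
  refine finsum_eq_sum_of_support_subset _ fun v hv => ?_
  refine hs v fun h => hv ?_
  simp [h]

theorem co_pt (w : V) (t : I) (u : V) : R.co (R.pt w t) u =
    (if R.IsAnc u (R.parent w) then 1 - (t : ℝ) else 0) +
      (if R.IsAnc u w then (t : ℝ) else 0) := by
  have hs : ∀ v, (R.pt w t).1 v ≠ 0 → v ∈ ({R.parent w, w} : Finset V) := by
    intro v hv
    rw [pt_apply] at hv
    by_contra h
    simp only [Finset.mem_insert, Finset.mem_singleton, not_or] at h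
    simp [h.1, h.2] at hv
  rw [R.co_eq_sum hs]
  have h : ∀ v, (if R.IsAnc u v then (R.pt w t).1 v else 0) =
      (if v = R.parent w then (if R.IsAnc u (R.parent w) then 1 - (t : ℝ) else 0) else 0) +
      (if v = w then (if R.IsAnc u w then (t : ℝ) else 0) else 0) := by
    intro v
    rw [pt_apply]
    by_cases h₁ : v = R.parent w <;> by_cases h₂ : v = w
    · subst h₂; rw [← h₁]; split_ifs <;> simp
    · subst h₁; simp [h₂]
    · subst h₂; simp [h₁]
    · simp [h₁, h₂]
  simp [h, Finset.sum_add_distrib]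

theorem co_vert (w u : V) : R.co (Realization.vert G w) u = if R.IsAnc u w then 1 else 0 := by
  rw [← R.pt_one, co_pt]; simp

theorem val_nonneg (R : Rooting G) (x : Realization G) (v : V) : 0 ≤ x.1 v := by
  obtain ⟨w, t, ht, rfl⟩ := R.exists_eq_pt x
  have := t.2.2
  rw [pt_apply]
  split_ifs <;> linarith

theorem exists_val_pos (R : Rooting G) (x : Realization G) : ∃ v, 0 < x.1 v := by
  obtain ⟨w, t, ht, rfl⟩ := R.exists_eq_pt x
  have := t.2.2
  refine ⟨w, ?_⟩
  rw [pt_apply, if_pos (rfl : w = w)]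
  split_ifs <;> linarith

theorem depth_le_of_val_ne_zero (R : Rooting G) {x : Realization G} {v w : V} (hv : x.1 v ≠ 0)
    (hw : x.1 w ≠ 0) : R.depth w ≤ R.depth v + 1 := by
  obtain ⟨u, t, ht, rfl⟩ := R.exists_eq_pt x
  rw [pt_apply] at hv hw
  have := R.depth_parent u
  have hmem : ∀ z, (if z = R.parent u then 1 - (t : ℝ) else 0) +
      (if z = u then (t : ℝ) else 0) ≠ 0 → z = R.parent u ∨ z = u := by
    intro z hz
    by_contra! h
    simp [h.1, h.2] at hz
  rcases hmem v hv with rfl | rfl <;> rcases hmem w hw with rfl | rfl <;> omega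

theorem finite_support (R : Rooting G) (x : Realization G) :
    ∃ s : Finset V, ∀ v, x.1 v ≠ 0 → v ∈ s := by
  obtain ⟨v, hv⟩ := R.exists_val_pos x
  refine ⟨(R.finite_depth_lt (R.depth v + 2)).toFinset, fun w hw => ?_⟩
  have := R.depth_le_of_val_ne_zero hv.ne' hw
  simp
  omega

theorem co_nonneg (x : Realization G) (w : V) : 0 ≤ R.co x w :=
  finsum_nonneg fun v => by split_ifs <;> simp [R.val_nonneg]

theorem co_pos_iff {x : Realization G} {w : V} :
    0 < R.co x w ↔ ∃ v, R.IsAnc w v ∧ x.1 v ≠ 0 := by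
  obtain ⟨s, hs⟩ := R.finite_support x
  rw [R.co_eq_sum hs, Finset.sum_pos_iff_of_nonneg fun v _ => by
    split_ifs <;> simp [R.val_nonneg]]
  constructor
  · rintro ⟨v, _, hv⟩
    split_ifs at hv with h
    · exact ⟨v, h, hv.ne'⟩
    · exact (lt_irrefl _ hv).elim
  · rintro ⟨v, h, hv⟩
    exact ⟨v, hs v hv, by rw [if_pos h]; exact (R.val_nonneg x v).lt_of_ne' hv⟩

/-- The properties that characterize the ancestor coordinates of a point of the realization. -/
structure IsTreeCoord (s : V → ℝ) : Prop where
  nonneg : ∀ v, 0 ≤ s v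
  le_one : ∀ v, s v ≤ 1
  root : s R.root = 1
  parent : ∀ v, 0 < s v → s (R.parent v) = 1
  unique : ∀ v w, 0 < s v → 0 < s w → R.depth v = R.depth w → v = w
  bounded : ∃ n, ∀ v, n ≤ R.depth v → s v = 0

theorem isTreeCoord_co (x : Realization G) : R.IsTreeCoord (R.co x) := by
  obtain ⟨w, t, ht, rfl⟩ := R.exists_eq_pt x
  have ht1 := t.2.2
  have hanc : ∀ u, 0 < R.co (R.pt w t) u → R.IsAnc u w := by
    intro u hu
    by_contra h
    rw [co_pt, if_neg h, if_neg fun h' => h (h'.trans (R.isAnc_parent w))] at hu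
    simp at hu
  refine ⟨R.co_nonneg _, fun u => ?_, ?_, fun u hu => ?_, fun u v hu hv h => ?_,
    R.depth w + 1, fun u hu => ?_⟩
  · rw [co_pt]; split_ifs <;> linarith
  · rw [co_pt, if_pos (R.isAnc_root _), if_pos (R.isAnc_root _)]; ring
  · have h := hanc u hu
    have h' : R.IsAnc (R.parent u) (R.parent w) := by
      by_cases huw : u = w
      · rw [huw]; exact R.isAnc_refl _
      · by_cases hw : w = R.root
        · have := h.depth_le
          rw [hw, R.depth_root] at this
          exact (huw (by rw [hw, ← R.depth_eq_zero_iff]; omega)).elim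
        · exact (R.isAnc_parent u).trans ((R.isAnc_parent_iff hw).2 ⟨h, huw⟩)
    rw [co_pt, if_pos h', if_pos (h'.trans (R.isAnc_parent w))]
    ring
  · exact (hanc u hu).eq_of_depth_eq (hanc v hv) h
  · by_contra h
    have := (hanc u ((R.co_nonneg _ u).lt_of_ne' h)).depth_le
    omega

variable {R} in
theorem IsTreeCoord.eq_one_of_isAnc {s : V → ℝ} (hs : R.IsTreeCoord s) {u v : V} (hu : 0 < s u)
    (h : R.IsAnc v u) (hne : v ≠ u) : s v = 1 := by
  have key : ∀ k, k < R.depth u → s (R.anc u (R.depth u - 1 - k)) = 1 := by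
    intro k
    induction k with
    | zero => intro _; rw [Nat.sub_zero, R.anc_depth_sub_one]; exact hs.parent u hu
    | succ k ih =>
      intro hk
      rw [← R.parent_anc (by omega)]
      refine hs.parent _ ?_
      rw [show R.depth u - 1 - (k + 1) + 1 = R.depth u - 1 - k by omega, ih (by omega)]
      exact one_pos
  have hlt : R.depth v < R.depth u := lt_of_le_of_ne h.depth_le fun h' =>
    hne (h.eq_of_depth_eq (R.isAnc_refl u) h')
  have := key (R.depth u - 1 - R.depth v) (by omega)
  rwa [show R.depth u - 1 - (R.depth u - 1 - R.depth v) = R.depth v by omega, h] at this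

theorem exists_co_eq {s : V → ℝ} (hs : R.IsTreeCoord s) : ∃ x : Realization G, R.co x = s := by
  -- the point lies on the edge that leads to the deepest vertex `u` with nonzero coordinate
  have hfind := Nat.find_spec hs.bounded
  have hmin := fun m => Nat.find_min (H := hs.bounded) (m := m)
  set n := Nat.find hs.bounded
  have hn : n ≠ 0 := by
    intro h
    have := hfind R.root (by omega)
    rw [hs.root] at this
    exact one_ne_zero this
  have := hmin (n - 1) (by omega)
  push Not at this
  obtain ⟨u, hu, hsu⟩ := this
  have hpos : 0 < s u := (hs.nonneg u).lt_of_ne' hsu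
  have hud : R.depth u = n - 1 := by
    by_contra h
    exact hsu (hfind u (by omega))
  refine ⟨R.pt u ⟨s u, hs.nonneg u, hs.le_one u⟩, funext fun v => ?_⟩
  rw [co_pt]
  by_cases hv : R.IsAnc v u
  · by_cases hvu : v = u
    · subst hvu
      by_cases hr : v = R.root
      · rw [if_pos hv, if_pos (by rw [hr]; exact R.isAnc_root _)]; simp [hr, hs.root]
      · rw [if_pos hv, if_neg fun h => ((R.isAnc_parent_iff hr).1 h).2 rfl]; simp
    · have hr : u ≠ R.root := by
        rintro rfl
        have := hv.depth_le
        exact hvu (by rw [← R.depth_eq_zero_iff]; rw [R.depth_root] at this; omega)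
      rw [if_pos hv, if_pos ((R.isAnc_parent_iff hr).2 ⟨hv, hvu⟩),
        hs.eq_one_of_isAnc hpos hv hvu]
      simp
  · rw [if_neg hv, if_neg fun h => hv (h.trans (R.isAnc_parent u)), add_zero]
    by_contra h
    have hvpos : 0 < s v := (hs.nonneg v).lt_of_ne (fun h' => h h')
    have hvd : R.depth v ≤ R.depth u := by
      by_contra hlt
      exact h (hfind v (by omega)).symm
    refine hv ?_
    have hanc : 0 < s (R.anc u (R.depth v)) := by
      by_cases he : R.anc u (R.depth v) = u
      · rwa [he]
      · rw [hs.eq_one_of_isAnc hpos (R.isAnc_anc _ _) he]; exact one_pos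
    exact hs.unique _ _ hanc hvpos (by rw [R.depth_anc, min_eq_left hvd])

theorem val_eq_co_sub (x : Realization G) (v : V) :
    x.1 v = R.co x v - ∑ c ∈ R.children v, R.co x c := by
  -- by linearity this reduces to the following identity for the vertices `w`
  have key : ∀ w, (if v = w then (1 : ℝ) else 0) = (if R.IsAnc v w then 1 else 0) -
      ∑ c ∈ R.children v, if R.IsAnc c w then 1 else 0 := by
    intro w
    by_cases h : R.IsAnc v w ∧ v ≠ w
    · have hlt : R.depth v < R.depth w := lt_of_le_of_ne h.1.depth_le fun h' =>
        h.2 (h.1.eq_of_depth_eq (R.isAnc_refl w) h')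
      have hd : R.depth (R.anc w (R.depth v + 1)) = R.depth v + 1 := by
        rw [R.depth_anc]; omega
      have hc : R.anc w (R.depth v + 1) ∈ R.children v := by
        rw [R.mem_children, R.parent_anc hlt]
        exact ⟨R.ne_root_iff.2 (by omega), h.1⟩
      rw [Finset.sum_eq_single_of_mem _ hc, if_neg h.2, if_pos h.1, if_pos (R.isAnc_anc _ _)]
      · simp
      · intro c hc' hne
        refine if_neg fun hcw => hne (hcw.eq_of_depth_eq (R.isAnc_anc _ _) ?_)
        obtain ⟨hr, rfl⟩ := R.mem_children.1 hc'
        have := R.ne_root_iff.1 hr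
        rw [hd, R.depth_parent]
        omega
    · have hzero : ∀ c ∈ R.children v, (if R.IsAnc c w then (1 : ℝ) else 0) = 0 := by
        intro c hc
        refine if_neg fun hcw => h ?_
        obtain ⟨hr, rfl⟩ := R.mem_children.1 hc
        refine ⟨(R.isAnc_parent c).trans hcw, fun hpw => ?_⟩
        have h₁ := hcw.depth_le
        have h₂ := R.ne_root_iff.1 hr
        rw [← hpw, R.depth_parent] at h₁
        omega
      rw [Finset.sum_eq_zero hzero, sub_zero]
      by_cases hvw : v = w
      · rw [if_pos hvw, if_pos (hvw ▸ R.isAnc_refl v)]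
      · rw [if_neg hvw, if_neg fun h' => h ⟨h', hvw⟩]
  obtain ⟨w, t, ht, rfl⟩ := R.exists_eq_pt x
  have h : ∀ u, R.co (R.pt w t) u = (1 - (t : ℝ)) * (if R.IsAnc u (R.parent w) then 1 else 0) +
      t * (if R.IsAnc u w then 1 else 0) := by
    intro u; rw [co_pt]; simp
  have h' : (R.pt w t).1 v = (1 - (t : ℝ)) * (if v = R.parent w then 1 else 0) +
      t * (if v = w then 1 else 0) := by rw [pt_apply]; simp
  simp only [h, h', key, Finset.sum_add_distrib, ← Finset.mul_sum]
  ring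

theorem co_injective : Function.Injective R.co := by
  intro x y h
  refine Subtype.ext (funext fun v => ?_)
  rw [R.val_eq_co_sub x, R.val_eq_co_sub y, h]

theorem continuous_co : Continuous R.co := by
  refine continuous_pi fun u => continuous_iff_continuousAt.2 fun x₀ => ?_
  have hval : ∀ v, Continuous fun x : Realization G => x.1 v := fun v =>
    (continuous_apply v).comp continuous_subtype_val
  -- near a point with positive `v`-coordinate, all supports lie in a fixed finite set
  obtain ⟨v, hv⟩ := R.exists_val_pos x₀
  have hev : ∀ᶠ x in 𝓝 x₀, 0 < x.1 v := (hval v).continuousAt.eventually (lt_mem_nhds hv)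
  refine ContinuousAt.congr (f := fun x : Realization G =>
    ∑ w ∈ (R.finite_depth_lt (R.depth v + 2)).toFinset, if R.IsAnc u w then x.1 w else 0) ?_ ?_
  · refine Continuous.continuousAt (continuous_finsetSum _ fun w _ => ?_)
    split_ifs
    · exact hval w
    · exact continuous_const
  · filter_upwards [hev] with x hx
    refine (R.co_eq_sum (fun w hw => ?_) u).symm
    have := R.depth_le_of_val_ne_zero hx.ne' hw
    simp
    omega

/-- The topology of the realization is that of pointwise convergence of ancestor coordinates. -/
theorem isInducing_co : IsInducing R.co := by
  refine IsInducing.of_comp (g := fun (s : V → ℝ) v => s v - ∑ c ∈ R.children v, s c)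
    R.continuous_co (by fun_prop) ?_
  have : (fun (s : V → ℝ) v => s v - ∑ c ∈ R.children v, s c) ∘ R.co = Subtype.val :=
    funext fun x => funext fun v => (R.val_eq_co_sub x v).symm
  rw [this]
  exact IsInducing.subtypeVal

theorem continuous_iff_co {Z : Type*} [TopologicalSpace Z] {f : Z → Realization G} :
    Continuous f ↔ ∀ w, Continuous fun z => R.co (f z) w := by
  rw [R.isInducing_co.continuous_iff, continuous_pi_iff]
  rfl

theorem continuous_co_apply (w : V) : Continuous fun x => R.co x w :=
  R.continuous_iff_co.1 continuous_id w

end Rooting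

/-! ### Balls, branches and geodesic homotopies -/

namespace Rooting

variable {G : SimpleGraph V} (R : Rooting G)

/-- The subtree of the realization spanned by the vertices of depth less than `n`. -/
def ball (n : ℕ) : Set (Realization G) := {x | ∀ w, n ≤ R.depth w → x.1 w = 0}

/-- The branch at `w`: the component, containing `w`, of what remains of the realization when the
parent of `w` is removed. The branch at the root is everything. -/
def branch (w : V) : Set (Realization G) := {x | 0 < R.co x w}

theorem mem_branch {x : Realization G} {w : V} : x ∈ R.branch w ↔ 0 < R.co x w := Iff.rfl

theorem notMem_ball_iff {n : ℕ} {x : Realization G} :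
    x ∉ R.ball n ↔ ∃ w, R.depth w = n ∧ x ∈ R.branch w := by
  constructor
  · intro h
    simp only [ball, mem_ofPred_eq, not_forall] at h
    obtain ⟨v, hv, hx⟩ := h
    exact ⟨R.anc v n, by rw [R.depth_anc, min_eq_left hv], R.co_pos_iff.2 ⟨v, R.isAnc_anc v n, hx⟩⟩
  · rintro ⟨w, rfl, hx⟩ h
    obtain ⟨v, hv, hxv⟩ := R.co_pos_iff.1 hx
    exact hxv (h v hv.depth_le)

theorem ball_mono {m n : ℕ} (h : m ≤ n) : R.ball m ⊆ R.ball n :=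
  fun _ hx w hw => hx w (h.trans hw)

theorem isCompact_ball (n : ℕ) : IsCompact (R.ball n) := by
  have h : R.ball n = ⋃ w ∈ {w | R.depth w < n}, range (R.pt w) := by
    ext x
    simp only [mem_iUnion, mem_range, exists_prop, mem_ofPred_eq]
    constructor
    · intro hx
      obtain ⟨w, t, ht, rfl⟩ := R.exists_eq_pt x
      refine ⟨w, ?_, t, rfl⟩
      by_contra hw
      have h₀ := hx w (by omega)
      have := t.2.2
      rw [pt_apply, if_pos (rfl : w = w)] at h₀
      split_ifs at h₀ <;> linarith
    · rintro ⟨w, hw, t, rfl⟩ v hv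
      have hp := R.depth_parent w
      rw [pt_apply, if_neg (by rintro rfl; omega), if_neg (by rintro rfl; omega), add_zero]
  rw [h]
  exact (R.finite_depth_lt n).isCompact_biUnion fun w _ => isCompact_range (R.continuous_pt w)

/-- The subtree spanned by the vertices of depth less than `n`, as a compact set. -/
def ballCompacts (n : ℕ) : Compacts (Realization G) := ⟨R.ball n, R.isCompact_ball n⟩

theorem isOpen_branch (w : V) : IsOpen (R.branch w) :=
  isOpen_lt continuous_const (R.continuous_co_apply w)

theorem branch_subset_compl_ball {w : V} {n : ℕ} (h : n ≤ R.depth w) :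
    R.branch w ⊆ (R.ball n)ᶜ := by
  intro x hx hx'
  obtain ⟨v, hv, hxv⟩ := R.co_pos_iff.1 hx
  exact hxv (hx' v (h.trans hv.depth_le))

theorem eq_of_mem_branch {x : Realization G} {v w : V} (hv : x ∈ R.branch v)
    (hw : x ∈ R.branch w) (h : R.depth v = R.depth w) : v = w :=
  (R.isTreeCoord_co x).unique v w hv hw h

theorem branch_subset_branch {u v : V} (h : R.IsAnc u v) : R.branch v ⊆ R.branch u := by
  intro x hx
  obtain ⟨w, hw, hxw⟩ := R.co_pos_iff.1 hx
  exact R.co_pos_iff.2 ⟨w, h.trans hw, hxw⟩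

theorem vert_mem_branch {v w : V} : Realization.vert G v ∈ R.branch w ↔ R.IsAnc w v := by
  rw [mem_branch, co_vert]
  split_ifs with h <;> simp [h]

/-- A connected set that avoids a ball stays in one branch. -/
theorem subset_branch {S : Set (Realization G)} (hS : IsPreconnected S) {n : ℕ}
    (hSn : S ⊆ (R.ball n)ᶜ) {w : V} (hw : R.depth w = n) {x : Realization G} (hx : x ∈ S)
    (hxw : x ∈ R.branch w) : S ⊆ R.branch w := by
  refine hS.subset_left_of_subset_union (R.isOpen_branch w)
    (v := ⋃ v ∈ {v | R.depth v = n ∧ v ≠ w}, R.branch v)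
    (isOpen_biUnion fun v _ => R.isOpen_branch v) ?_ ?_ ⟨x, hx, hxw⟩
  · rw [Set.disjoint_left]
    intro y hy hy'
    simp only [mem_iUnion, exists_prop] at hy'
    obtain ⟨v, ⟨hv, hne⟩, hyv⟩ := hy'
    exact hne (R.eq_of_mem_branch hyv hy (hv.trans hw.symm))
  · intro y hy
    obtain ⟨v, hv, hyv⟩ := R.notMem_ball_iff.1 (hSn hy)
    by_cases h : v = w
    · exact Or.inl (h ▸ hyv)
    · exact Or.inr (mem_biUnion (x := v) ⟨hv, h⟩ hyv)

/-- The points of the realization all of whose coordinates at depth `n` are less than one. This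
is an open set between `ball n` and `ball (n + 1)`. -/
def openBall (n : ℕ) : Set (Realization G) := {x | ∀ w, R.depth w = n → R.co x w < 1}

theorem isOpen_openBall (n : ℕ) : IsOpen (R.openBall n) := by
  have : R.openBall n = ⋂ w ∈ {w | R.depth w = n}, {x | R.co x w < 1} := by
    ext x; simp [openBall]
  rw [this]
  exact (R.finite_level n).isOpen_biInter fun w _ =>
    isOpen_lt (R.continuous_co_apply w) continuous_const

theorem ball_subset_openBall (n : ℕ) : R.ball n ⊆ R.openBall n := by
  intro x hx w hw
  by_contra h
  exact R.notMem_ball_iff.2 ⟨w, hw, show 0 < R.co x w by linarith⟩ hx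

theorem openBall_subset_ball (n : ℕ) : R.openBall n ⊆ R.ball (n + 1) := by
  intro x hx
  by_contra h
  obtain ⟨w, hw, hxw⟩ := R.notMem_ball_iff.1 h
  have := hx (R.parent w) (by rw [R.depth_parent]; omega)
  rw [(R.isTreeCoord_co x).parent w hxw] at this
  exact lt_irrefl _ this

theorem exists_mem_ball (x : Realization G) : ∃ n, x ∈ R.ball n := by
  obtain ⟨n, hn⟩ := (R.isTreeCoord_co x).bounded
  refine ⟨n, ?_⟩
  by_contra h
  obtain ⟨w, hw, hxw⟩ := R.notMem_ball_iff.1 h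
  exact hxw.ne' (hn w hw.ge)

theorem exists_subset_ball {K : Set (Realization G)} (hK : IsCompact K) : ∃ n, K ⊆ R.ball n := by
  have hmono : Monotone R.openBall := monotone_nat_of_le_succ fun n =>
    (R.openBall_subset_ball n).trans (R.ball_subset_openBall _)
  obtain ⟨n, hn⟩ := hK.elim_directed_cover R.openBall R.isOpen_openBall (fun x _ => by
    obtain ⟨n, hn⟩ := R.exists_mem_ball x
    exact mem_iUnion.2 ⟨n, R.ball_subset_openBall n hn⟩) (directed_of_isDirected_le hmono)
  exact ⟨n + 1, hn.trans (R.openBall_subset_ball n)⟩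

theorem weaklyLocallyCompactSpace (R : Rooting G) : WeaklyLocallyCompactSpace (Realization G) where
  exists_compact_mem_nhds x := by
    obtain ⟨n, hn⟩ := R.exists_mem_ball x
    exact ⟨R.ball (n + 1), R.isCompact_ball _, mem_of_superset
      ((R.isOpen_openBall n).mem_nhds (R.ball_subset_openBall n hn)) (R.openBall_subset_ball n)⟩

/-- A continuous map into the realization is proper if preimages of balls lie in compact sets. -/
theorem isProperMap_of_preimage_ball {Z : Type*} [TopologicalSpace Z] {f : Z → Realization G}
    (hf : Continuous f) (h : ∀ n, ∃ K, IsCompact K ∧ f ⁻¹' R.ball n ⊆ K) : IsProperMap f := by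
  have := R.weaklyLocallyCompactSpace
  rw [isProperMap_iff_isCompact_preimage]
  refine ⟨hf, fun K hK => ?_⟩
  obtain ⟨n, hn⟩ := R.exists_subset_ball hK
  obtain ⟨L, hL, hsub⟩ := h n
  exact hL.of_isClosed_subset (hK.isClosed.preimage hf) ((preimage_mono hn).trans hsub)

/-- A cutoff that retracts the tree to its root: for `n ≥ 1`, as `t` runs from `1 / (n + 1)` to
`1 / n`, the upper bound that it imposes on the coordinates of depth `n` decreases linearly from one
to zero. Levels far from the root are thus moved first, and the root is fixed. -/
noncomputable def cutoff (t : I) (n : ℕ) : ℝ := max 0 (min 1 ((n + 1) * (1 - t * n)))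

theorem continuous_cutoff (n : ℕ) : Continuous fun t => cutoff t n := by
  unfold cutoff; fun_prop

theorem cutoff_zero_left (n : ℕ) : cutoff 0 n = 1 := by simp [cutoff]

theorem cutoff_zero_right (t : I) : cutoff t 0 = 1 := by simp [cutoff]

theorem cutoff_one {n : ℕ} (h : 0 < n) : cutoff 1 n = 0 := by
  have : (1 : ℝ) ≤ n := by exact_mod_cast h
  refine max_eq_left (min_le_of_right_le ?_)
  simp only [Icc.coe_one, one_mul]
  nlinarith

theorem one_le_cutoff {t : I} {n : ℕ} (h : 0 < cutoff t (n + 1)) : 1 ≤ cutoff t n := by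
  have h' : 0 < ((n + 1 : ℕ) + 1 : ℝ) * (1 - t * (n + 1 : ℕ)) := by
    rcases lt_max_iff.1 h with h | h
    · exact (lt_irrefl _ h).elim
    · exact (lt_min_iff.1 h).2
  have ht : 0 < 1 - (t : ℝ) * (n + 1 : ℕ) := (pos_iff_pos_of_mul_pos h').1 (by positivity)
  push_cast at ht
  refine le_max_of_le_right (le_min le_rfl ?_)
  have := t.2.1
  nlinarith

theorem isTreeCoord_min {s q : V → ℝ} (hs : R.IsTreeCoord s) (hq : ∀ v, 0 ≤ q v)
    (hroot : 1 ≤ q R.root) (hparent : ∀ v, 0 < q v → 1 ≤ q (R.parent v)) :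
    R.IsTreeCoord fun v => min (s v) (q v) where
  nonneg v := le_min (hs.nonneg v) (hq v)
  le_one v := min_le_of_left_le (hs.le_one v)
  root := by rw [hs.root]; exact min_eq_left hroot
  parent v hv := by
    rw [lt_min_iff] at hv
    rw [hs.parent v hv.1]
    exact min_eq_left (hparent v hv.2)
  unique v w hv hw := hs.unique v w (lt_min_iff.1 hv).1 (lt_min_iff.1 hw).1
  bounded := by
    obtain ⟨n, hn⟩ := hs.bounded
    exact ⟨n, fun v hv => by rw [hn v hv]; exact min_eq_left (hq v)⟩

theorem isTreeCoord_cut (t : I) (a b : Realization G) : R.IsTreeCoord fun w =>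
    min (R.co a w) (max (R.co b w) (cutoff t (R.depth w))) := by
  refine R.isTreeCoord_min (R.isTreeCoord_co a) (fun v => le_max_of_le_left (R.co_nonneg b v))
    (le_max_of_le_left (R.isTreeCoord_co b).root.ge) fun v hv => ?_
  rcases lt_max_iff.1 hv with h | h
  · exact le_max_of_le_left ((R.isTreeCoord_co b).parent v h).ge
  · refine le_max_of_le_right ?_
    rw [R.depth_parent]
    rcases Nat.eq_zero_or_pos (R.depth v) with h₀ | h₀
    · rw [h₀, cutoff_zero_right]
    · exact one_le_cutoff (by rwa [Nat.sub_add_cancel h₀])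

/-- The point at time `t` of the path that moves from `a` towards the root until it reaches the
last common point of the paths from the root to `a` and to `b`. -/
noncomputable def cut (t : I) (a b : Realization G) : Realization G :=
  (R.exists_co_eq (R.isTreeCoord_cut t a b)).choose

theorem co_cut (t : I) (a b : Realization G) (w : V) :
    R.co (R.cut t a b) w = min (R.co a w) (max (R.co b w) (cutoff t (R.depth w))) :=
  congrFun (R.exists_co_eq (R.isTreeCoord_cut t a b)).choose_spec w

theorem continuous_cut {Z : Type*} [TopologicalSpace Z] {t : Z → I} {f g : Z → Realization G}
    (ht : Continuous t) (hf : Continuous f) (hg : Continuous g) :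
    Continuous fun z => R.cut (t z) (f z) (g z) := by
  rw [R.continuous_iff_co] at hf hg ⊢
  intro w
  simp only [co_cut]
  exact (hf w).min ((hg w).max ((continuous_cutoff _).comp ht))

theorem cut_zero (a b : Realization G) : R.cut 0 a b = a := by
  refine R.co_injective (funext fun w => ?_)
  rw [co_cut, cutoff_zero_left]
  exact min_eq_left (le_max_of_le_right ((R.isTreeCoord_co a).le_one w))

theorem cut_one_comm (a b : Realization G) : R.cut 1 a b = R.cut 1 b a := by
  refine R.co_injective (funext fun w => ?_)
  rw [co_cut, co_cut]
  rcases Nat.eq_zero_or_pos (R.depth w) with h | h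
  · rw [(R.depth_eq_zero_iff w).1 h, (R.isTreeCoord_co a).root, (R.isTreeCoord_co b).root]
  · rw [cutoff_one h, max_eq_left (R.co_nonneg _ _), max_eq_left (R.co_nonneg _ _), min_comm]

theorem cut_mem_branch {t : I} {a b : Realization G} {w : V} (ha : a ∈ R.branch w)
    (hb : b ∈ R.branch w) : R.cut t a b ∈ R.branch w := by
  rw [mem_branch, co_cut]
  exact lt_min ha (lt_max_of_lt_left hb)

theorem isPreconnected_branch (w : V) : IsPreconnected (R.branch w) := by
  refine isPreconnected_of_forall_pair fun a ha b hb => ?_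
  have hpre : ∀ a b : Realization G, IsPreconnected (range fun t => R.cut t a b) := fun a b =>
    isPreconnected_range (R.continuous_cut continuous_id continuous_const continuous_const)
  refine ⟨(range fun t => R.cut t a b) ∪ range fun t => R.cut t b a, ?_,
    Or.inl ⟨0, R.cut_zero a b⟩, Or.inr ⟨0, R.cut_zero b a⟩,
    (hpre a b).union (R.cut 1 a b) ⟨1, rfl⟩ ⟨1, R.cut_one_comm b a⟩ (hpre b a)⟩
  rintro x (⟨t, rfl⟩ | ⟨t, rfl⟩)
  · exact R.cut_mem_branch ha hb
  · exact R.cut_mem_branch hb ha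

/-- Two proper maps into a tree are properly homotopic if far out they have their values in the
same branches: both can be moved along geodesics to their last common point. -/
theorem properlyHomotopic_of_branch {X : Type*} [TopologicalSpace X]
    {f g : C(X, Realization G)}
    (h : ∀ n, ∃ K, IsCompact K ∧ ∀ x ∉ K, ∃ w, R.depth w = n ∧ f x ∈ R.branch w ∧
      g x ∈ R.branch w) : ProperlyHomotopic f g := by
  have key : ∀ f g : C(X, Realization G),
      (∀ n, ∃ K, IsCompact K ∧ ∀ x ∉ K, ∃ w, R.depth w = n ∧ f x ∈ R.branch w ∧
        g x ∈ R.branch w) → ∀ m : C(X, Realization G), (∀ x, R.cut 1 (f x) (g x) = m x) →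
      ProperlyHomotopic f m := by
    intro f g h m hm
    have hc : Continuous fun p : I × X => R.cut p.1 (f p.2) (g p.2) :=
      R.continuous_cut continuous_fst (by fun_prop) (by fun_prop)
    refine ⟨⟨⟨fun p => R.cut p.1 (f p.2) (g p.2), hc⟩, fun x => R.cut_zero _ _, hm⟩, ?_⟩
    refine R.isProperMap_of_preimage_ball hc fun n => ?_
    obtain ⟨K, hK, hKn⟩ := h n
    refine ⟨univ ×ˢ K, isCompact_univ.prod hK, ?_⟩
    rintro ⟨t, x⟩ hx
    refine ⟨mem_univ _, ?_⟩
    by_contra hxK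
    obtain ⟨w, hw, hfw, hgw⟩ := hKn x hxK
    exact R.notMem_ball_iff.2 ⟨w, hw, R.cut_mem_branch hfw hgw⟩ hx
  let m : C(X, Realization G) := ⟨fun x => R.cut 1 (f x) (g x),
    R.continuous_cut continuous_const f.continuous g.continuous⟩
  refine (key f g h m fun x => rfl).trans (key g f (fun n => ?_) m fun x => ?_).symm
  · obtain ⟨K, hK, hKn⟩ := h n
    refine ⟨K, hK, fun x hx => ?_⟩
    obtain ⟨w, hw, h₁, h₂⟩ := hKn x hx
    exact ⟨w, hw, h₂, h₁⟩
  · exact R.cut_one_comm _ _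

end Rooting

/-! ### Ends of rooted trees -/

namespace Rooting

variable {G : SimpleGraph V} (R : Rooting G) {G' : SimpleGraph W} (S : Rooting G')

theorem exists_comp_ball_eq (e : Ends (Realization G)) (n : ℕ) :
    ∃ w, R.depth w = n ∧ e.comp (R.ballCompacts n) = R.branch w := by
  obtain ⟨x, hx⟩ := e.comp_nonempty (R.ballCompacts n)
  obtain ⟨w, hw, hxw⟩ := R.notMem_ball_iff.1 (e.comp_subset (R.ballCompacts n) hx)
  refine ⟨w, hw, subset_antisymm ?_ ?_⟩
  · exact R.subset_branch (e.isPreconnected_comp _) (e.comp_subset _) hw hx hxw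
  · exact e.subset_comp (R.isPreconnected_branch w) (R.branch_subset_compl_ball hw.ge) hxw hx

/-- The vertex of depth `n` on the ray from the root to the end `e`. -/
noncomputable def lev (e : Ends (Realization G)) (n : ℕ) : V := (R.exists_comp_ball_eq e n).choose

theorem depth_lev (e : Ends (Realization G)) (n : ℕ) : R.depth (R.lev e n) = n :=
  (R.exists_comp_ball_eq e n).choose_spec.1

theorem comp_ballCompacts (e : Ends (Realization G)) (n : ℕ) :
    e.comp (R.ballCompacts n) = R.branch (R.lev e n) :=
  (R.exists_comp_ball_eq e n).choose_spec.2

theorem lev_eq_of_mem {e : Ends (Realization G)} {n : ℕ} {x : Realization G} {w : V}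
    (hx : x ∈ e.comp (R.ballCompacts n)) (hw : R.depth w = n) (hxw : x ∈ R.branch w) :
    R.lev e n = w := by
  rw [comp_ballCompacts] at hx
  exact R.eq_of_mem_branch hx hxw (by rw [depth_lev, hw])

theorem lev_zero (e : Ends (Realization G)) : R.lev e 0 = R.root :=
  (R.depth_eq_zero_iff _).1 (R.depth_lev e 0)

theorem vert_mem_branch_self (w : V) : Realization.vert G w ∈ R.branch w :=
  R.vert_mem_branch.2 (R.isAnc_refl w)

theorem isAnc_lev (e : Ends (Realization G)) {m n : ℕ} (h : m ≤ n) :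
    R.IsAnc (R.lev e m) (R.lev e n) := by
  rw [← R.vert_mem_branch, ← comp_ballCompacts]
  refine e.compatible (R.ballCompacts m) (R.ballCompacts n) (R.ball_mono h) ?_
  rw [comp_ballCompacts]
  exact R.vert_mem_branch_self _

theorem anc_lev (e : Ends (Realization G)) {m n : ℕ} (h : m ≤ n) :
    R.anc (R.lev e n) m = R.lev e m := by
  have := R.isAnc_lev e h
  rwa [IsAnc, depth_lev] at this

theorem parent_lev (e : Ends (Realization G)) (n : ℕ) :
    R.parent (R.lev e (n + 1)) = R.lev e n := by
  rw [← R.anc_depth_sub_one, depth_lev, Nat.add_sub_cancel, R.anc_lev e (Nat.le_succ n)]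

theorem branch_lev_subset (e : Ends (Realization G)) {K : Compacts (Realization G)} {m n : ℕ}
    (hK : (K : Set (Realization G)) ⊆ R.ball m) (h : m ≤ n) :
    R.branch (R.lev e n) ⊆ e.comp K := by
  rw [← comp_ballCompacts]
  exact e.compatible _ _ (hK.trans (R.ball_mono h))

/-- An end of a rooted tree is determined by the ray that converges to it. -/
theorem ends_ext {e e' : Ends (Realization G)} (h : ∀ n, R.lev e n = R.lev e' n) : e = e' := by
  refine Ends.ext (funext fun K => ?_)
  obtain ⟨n, hn⟩ := R.exists_subset_ball K.isCompact
  have hv := R.vert_mem_branch_self (R.lev e n)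
  exact Ends.comp_eq_comp e e' (R.branch_lev_subset e hn le_rfl hv)
    (R.branch_lev_subset e' hn le_rfl (h n ▸ hv))

theorem exists_mapsTo_branch_endMap (f : ProperMap (Realization G) (Realization G')) (n : ℕ) :
    ∃ M, ∀ e m, M ≤ m → MapsTo f.1 (R.branch (R.lev e m)) (S.branch (S.lev (f.endMap e) n)) := by
  obtain ⟨M, hM⟩ := R.exists_subset_ball (f.preimage (S.ballCompacts n)).isCompact
  refine ⟨M, fun e m hm x hx => ?_⟩
  rw [← comp_ballCompacts]
  exact f.mapsTo_endMap e le_rfl (R.branch_lev_subset e hM hm hx)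

/-- The map of ends induced by a proper map is uniformly continuous. -/
theorem exists_lev_endMap_eq (f : ProperMap (Realization G) (Realization G')) (n : ℕ) :
    ∃ m, ∀ e e', R.lev e m = R.lev e' m → S.lev (f.endMap e) n = S.lev (f.endMap e') n := by
  obtain ⟨m, hm⟩ := R.exists_mapsTo_branch_endMap S f n
  refine ⟨m, fun e e' h => ?_⟩
  have hv := R.vert_mem_branch_self (R.lev e m)
  exact S.eq_of_mem_branch (hm e m le_rfl hv) (hm e' m le_rfl (h ▸ hv))
    (by rw [depth_lev, depth_lev])

theorem lev_endMap_eq (f : ProperMap (Realization G) (Realization G'))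
    (e : Ends (Realization G)) {w : W}
    (h : ∀ M, ∃ m, M ≤ m ∧ f.1 (Realization.vert G (R.lev e m)) ∈ S.branch w) :
    S.lev (f.endMap e) (S.depth w) = w := by
  obtain ⟨M, hM⟩ := R.exists_mapsTo_branch_endMap S f (S.depth w)
  obtain ⟨m, hm, hw⟩ := h M
  exact S.eq_of_mem_branch (hM e m hm (R.vert_mem_branch_self _)) hw (S.depth_lev _ _)

/-- A sequence of vertices that starts at the root and descends by one level at each step. -/
structure IsRay (r : ℕ → V) : Prop where
  depth : ∀ n, R.depth (r n) = n
  parent : ∀ n, R.parent (r (n + 1)) = r n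

theorem isRay_lev (e : Ends (Realization G)) : R.IsRay (R.lev e) :=
  ⟨R.depth_lev e, R.parent_lev e⟩

variable {R} in
theorem IsRay.isAnc {r : ℕ → V} (hr : R.IsRay r) {m n : ℕ} (h : m ≤ n) :
    R.IsAnc (r m) (r n) := by
  induction n, h using Nat.le_induction with
  | base => exact R.isAnc_refl _
  | succ n _ ih =>
    refine ih.trans ?_
    rw [← hr.parent n]
    exact R.isAnc_parent _

/-- Every ray from the root converges to an end. -/
theorem exists_lev_eq {r : ℕ → V} (hr : R.IsRay r) :
    ∃ e : Ends (Realization G), R.lev e = r := by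
  choose N hN using fun K : Compacts (Realization G) => R.exists_subset_ball K.isCompact
  have hcomp : ∀ (K : Compacts (Realization G)) m n, (K : Set (Realization G)) ⊆ R.ball m →
      m ≤ n → Realization.vert G (r n) ∈
        connectedComponentIn (K : Set (Realization G))ᶜ (Realization.vert G (r m)) := by
    intro K m n hK h
    refine (R.isPreconnected_branch (r m)).subset_connectedComponentIn
      (R.vert_mem_branch_self _) ?_ (R.vert_mem_branch.2 (hr.isAnc h))
    exact (R.branch_subset_compl_ball (hr.depth m).ge).trans (compl_subset_compl.2 hK)
  let e : Ends (Realization G) :=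
    { comp := fun K => connectedComponentIn (K : Set (Realization G))ᶜ
        (Realization.vert G (r (N K)))
      isComponent := fun K => ⟨_, fun h => R.branch_subset_compl_ball (hr.depth (N K)).ge
        (R.vert_mem_branch_self _) (hN K h), rfl⟩
      compatible := by
        intro K L hKL
        refine (connectedComponentIn_mono _ (compl_subset_compl.2 hKL)).trans ?_
        rcases le_total (N K) (N L) with h | h
        · rw [connectedComponentIn_eq (hcomp K _ _ (hN K) h)]
        · rw [connectedComponentIn_eq
            (hcomp K _ _ (fun x hx => hN L (hKL hx)) h)] }
  refine ⟨e, funext fun n => ?_⟩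
  refine R.lev_eq_of_mem (x := Realization.vert G (r (max n (N (R.ballCompacts n))))) ?_
    (hr.depth n) (R.vert_mem_branch.2 (hr.isAnc (le_max_left _ _)))
  exact hcomp _ _ _ (hN _) (le_max_right _ _)

/-- Kőnig's lemma: there is an end beyond every vertex with arbitrarily deep descendants. -/
theorem exists_end_of_unbounded {v : V} (hv : ∀ N, ∃ u, R.IsAnc v u ∧ N ≤ R.depth u) :
    ∃ e : Ends (Realization G), R.lev e (R.depth v) = v := by
  let U : Set V := {v | ∀ N, ∃ u, R.IsAnc v u ∧ N ≤ R.depth u}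
  have hstep : ∀ v : U, ∃ c : U, R.parent c = v ∧ (c : V) ≠ R.root := by
    rintro ⟨v, hv⟩
    by_contra! hcon
    have hN : ∀ c, ∃ N, c ∈ R.children v → ∀ u, R.IsAnc c u → R.depth u < N := by
      intro c
      by_contra! h
      have hc := R.mem_children.1 (h 0).1
      exact hc.1 (hcon ⟨c, fun N => (h N).2⟩ hc.2)
    choose N hN using hN
    obtain ⟨u, hu, hud⟩ := hv (max (R.depth v + 1) ((R.children v).sup N))
    have hlt : R.depth v < R.depth u := (le_max_left _ _).trans hud
    have hc : R.anc u (R.depth v + 1) ∈ R.children v := by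
      rw [R.mem_children, R.parent_anc hlt]
      exact ⟨R.ne_root_iff.2 (by rw [R.depth_anc]; omega), hu⟩
    have h₁ := hN _ hc u (R.isAnc_anc _ _)
    have h₂ := Finset.le_sup (f := N) hc
    have h₃ := (le_max_right _ _).trans hud
    omega
  choose next hnext hne using hstep
  let s : ℕ → U := fun n => next^[n] ⟨v, hv⟩
  have hs : ∀ n, R.parent (s (n + 1)) = s n := fun n => by
    simp only [s, Function.iterate_succ_apply']
    exact hnext _
  have hsd : ∀ n, R.depth (s n) = R.depth v + n := by
    intro n
    induction n with
    | zero => rfl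
    | succ n ih =>
      have h₁ : R.depth (R.parent (s (n + 1))) = R.depth (s n) := by rw [hs]
      have h₂ : 0 < R.depth (s (n + 1)) := R.ne_root_iff.1 (by
        simp only [s, Function.iterate_succ_apply']; exact hne _)
      rw [R.depth_parent] at h₁
      omega
  have hsv : ∀ n, R.IsAnc v (s n) := by
    intro n
    induction n with
    | zero => exact R.isAnc_refl v
    | succ n ih =>
      refine ih.trans ?_
      rw [← hs n]
      exact R.isAnc_parent _
  obtain ⟨e, he⟩ := R.exists_lev_eq (r := fun n => R.anc (s n) n) ⟨fun n => by
    rw [R.depth_anc, hsd]; omega, fun n => by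
    rw [R.parent_anc (by rw [hsd]; omega), ← hs n, R.anc_parent (by rw [hsd]; omega)]⟩
  exact ⟨e, by rw [he]; exact hsv _⟩

/-- Beyond a sufficiently large depth, only vertices remain whose ancestors of depth `n` have an
end beyond them. -/
theorem exists_depth_forall_exists_end (n : ℕ) : ∃ N, n ≤ N ∧ ∀ u, N ≤ R.depth u →
    ∃ e : Ends (Realization G), R.lev e n = R.anc u n := by
  have h : ∀ w, ∃ N, R.depth w = n → ∀ u, R.IsAnc w u → N ≤ R.depth u →
      ∃ e : Ends (Realization G), R.lev e n = w := by
    intro w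
    by_cases hw : ∀ N, ∃ u, R.IsAnc w u ∧ N ≤ R.depth u
    · exact ⟨0, fun h _ _ _ => h ▸ R.exists_end_of_unbounded hw⟩
    · push Not at hw
      obtain ⟨N, hN⟩ := hw
      exact ⟨N, fun _ u hu hd => absurd (hN u hu) (by omega)⟩
  choose N hN using h
  refine ⟨max n ((R.finite_level n).toFinset.sup N), le_max_left _ _, fun u hu => ?_⟩
  have hd : R.depth (R.anc u n) = n := by
    rw [R.depth_anc]
    exact min_eq_left ((le_max_left _ _).trans hu)
  refine hN _ hd u (R.isAnc_anc u n) (le_trans ?_ ((le_max_right _ _).trans hu))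
  exact Finset.le_sup (f := N) (by simpa using hd)

/-- Proper maps between locally finite trees that induce the same map of ends are properly
homotopic. -/
theorem properlyHomotopic_of_endMap_eq (R : Rooting G) (S : Rooting G')
    {f g : ProperMap (Realization G) (Realization G')} (h : ∀ e, f.endMap e = g.endMap e) :
    ProperlyHomotopic f.1 g.1 := by
  refine S.properlyHomotopic_of_branch fun n => ?_
  obtain ⟨M, hM⟩ := R.exists_subset_ball
    (f.preimage (S.ballCompacts n) ⊔ g.preimage (S.ballCompacts n)).isCompact
  obtain ⟨N, hMN, hN⟩ := R.exists_depth_forall_exists_end M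
  refine ⟨R.ball N, R.isCompact_ball N, fun x hx => ?_⟩
  obtain ⟨u, hu, hxu⟩ := R.notMem_ball_iff.1 hx
  obtain ⟨e, he⟩ := hN u hu.ge
  have hxe : x ∈ R.branch (R.lev e M) := by
    rw [he]
    exact R.branch_subset_branch (R.isAnc_anc u M) hxu
  refine ⟨S.lev (f.endMap e) n, S.depth_lev _ _, ?_, ?_⟩
  · rw [← comp_ballCompacts]
    exact f.mapsTo_endMap e le_rfl
      (R.branch_lev_subset e (Subset.trans subset_union_left hM) le_rfl hxe)
  · rw [h e, ← comp_ballCompacts]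
    exact g.mapsTo_endMap e le_rfl
      (R.branch_lev_subset e (Subset.trans subset_union_right hM) le_rfl hxe)

theorem properClass_eq_of_endMap_eq (R : Rooting G) (S : Rooting G')
    {c d : ProperClass (Realization G) (Realization G')} (h : ∀ e, c.endMap e = d.endMap e) :
    c = d := by
  induction c using Quotient.inductionOn
  induction d using Quotient.inductionOn
  exact Quotient.sound (R.properlyHomotopic_of_endMap_eq S h)

end Rooting

/-! ### Compact sets of mapping classes -/

namespace Rooting

variable {G : SimpleGraph V} (R : Rooting G)

/-- The space of ends of a locally finite tree is compact, being a continuous image of the set of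
rays from the root, which is closed in the product of the levels. -/
theorem isCompact_range_ofEnd (R : Rooting G) :
    IsCompact (range (EndCompactification.ofEnd : Ends (Realization G) → _)) := by
  let _ : TopologicalSpace V := ⊥
  have : DiscreteTopology V := ⟨rfl⟩
  have hrays : IsCompact {r : ℕ → V | R.IsRay r} := by
    have hprod : IsCompact (Set.pi univ fun n => {v | R.depth v = n}) :=
      isCompact_univ_pi fun n => (R.finite_level n).isCompact
    have hclosed : IsClosed {r : ℕ → V | ∀ n, R.parent (r (n + 1)) = r n} := by
      simp only [ofPred_forall]
      exact isClosed_iInter fun n => isClosed_eq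
        (continuous_of_discreteTopology.comp (continuous_apply (n + 1))) (continuous_apply n)
    convert hprod.inter_right hclosed using 1
    ext r
    exact ⟨fun h => ⟨fun n _ => h.depth n, h.parent⟩, fun h => ⟨fun n => h.1 n trivial, h.2⟩⟩
  have := isCompact_iff_compactSpace.1 hrays
  choose E hE using fun r : {r : ℕ → V | R.IsRay r} => R.exists_lev_eq r.2
  have hcont : Continuous fun r => EndCompactification.ofEnd (E r) := by
    refine continuous_generateFrom_iff.2 ?_
    rintro _ (⟨U, hU, rfl⟩ | ⟨K, x, hx, rfl⟩)
    · convert isOpen_empty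
      refine eq_empty_iff_forall_notMem.2 ?_
      rintro r ⟨y, _, hy⟩
      cases hy
    · refine isOpen_iff_mem_nhds.2 fun r hr => ?_
      obtain ⟨n, hn⟩ := R.exists_subset_ball K.isCompact
      have hr' : (E r).comp K = connectedComponentIn (K : Set (Realization G))ᶜ x := by
        rcases hr with ⟨y, _, hy⟩ | ⟨e, he, hy⟩
        · cases hy
        · cases hy; exact he
      have hopen : IsOpen {r' : {r : ℕ → V | R.IsRay r} | r'.1 n = r.1 n} :=
        (isOpen_discrete {r.1 n}).preimage (f := fun r' : {r : ℕ → V | R.IsRay r} => r'.1 n)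
          ((continuous_apply n).comp continuous_subtype_val)
      filter_upwards [hopen.mem_nhds rfl] with r' h
      refine Or.inr ⟨E r', ?_, rfl⟩
      change (E r').comp K = _
      rw [← hr']
      have hlev : R.lev (E r') n = R.lev (E r) n := by rw [hE, hE]; exact h
      have hv := R.vert_mem_branch_self (R.lev (E r) n)
      exact Ends.comp_eq_comp _ _ (R.branch_lev_subset _ hn le_rfl (hlev ▸ hv))
        (R.branch_lev_subset _ hn le_rfl hv)
  convert isCompact_range hcont using 1
  ext z
  constructor
  · rintro ⟨e, rfl⟩
    refine ⟨⟨R.lev e, R.isRay_lev e⟩, ?_⟩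
    exact congrArg _ (R.ends_ext fun n => congrFun (hE _) n)
  · rintro ⟨r, rfl⟩
    exact ⟨_, rfl⟩

/-- The open set of all points and ends in the branch at `w`. -/
def hatBranch (w : V) : Set (EndCompactification (Realization G)) :=
  EndCompactification.hat (R.ballCompacts (R.depth w)) (R.branch w)

theorem ofPoint_mem_hatBranch {x : Realization G} {w : V} :
    EndCompactification.ofPoint x ∈ R.hatBranch w ↔ x ∈ R.branch w := by
  constructor
  · rintro (⟨y, hy, h⟩ | ⟨e, _, h⟩)
    · cases h; exact hy
    · cases h
  · exact fun h => Or.inl ⟨x, h, rfl⟩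

theorem ofEnd_mem_hatBranch {e : Ends (Realization G)} {w : V} :
    EndCompactification.ofEnd e ∈ R.hatBranch w ↔ R.lev e (R.depth w) = w := by
  constructor
  · rintro (⟨y, _, h⟩ | ⟨e', he, h⟩)
    · cases h
    · cases h
      refine R.lev_eq_of_mem (x := Realization.vert G w) ?_ rfl (R.vert_mem_branch_self w)
      rw [show e.comp _ = R.branch w from he]
      exact R.vert_mem_branch_self w
  · intro h
    refine Or.inr ⟨e, ?_, rfl⟩
    change e.comp _ = R.branch w
    rw [comp_ballCompacts, h]

theorem isOpen_hatBranch (w : V) : IsOpen (R.hatBranch w) := by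
  refine isOpen_generateFrom_of_mem (Or.inr ⟨R.ballCompacts (R.depth w), Realization.vert G w,
    R.branch_subset_compl_ball le_rfl (R.vert_mem_branch_self w), ?_⟩)
  rw [hatBranch]
  congr 1
  refine subset_antisymm ?_ ?_
  · exact (R.isPreconnected_branch w).subset_connectedComponentIn (R.vert_mem_branch_self w)
      (R.branch_subset_compl_ball le_rfl)
  · refine R.subset_branch isPreconnected_connectedComponentIn (connectedComponentIn_subset _ _)
      rfl ?_ (R.vert_mem_branch_self w)
    exact mem_connectedComponentIn
      (R.branch_subset_compl_ball le_rfl (R.vert_mem_branch_self w))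

theorem tendsto_vert_lev (e : Ends (Realization G)) :
    Tendsto (fun m => EndCompactification.ofPoint (Realization.vert G (R.lev e m))) atTop
      (𝓝 (EndCompactification.ofEnd e)) := by
  refine tendsto_nhds_generateFrom_iff.2 ?_
  rintro _ (⟨U, _, rfl⟩ | ⟨K, x, hx, rfl⟩) h
  · obtain ⟨y, _, hy⟩ := h
    cases hy
  · obtain ⟨n, hn⟩ := R.exists_subset_ball K.isCompact
    filter_upwards [eventually_ge_atTop n] with m hm
    refine Or.inl ⟨_, ?_, rfl⟩
    rcases h with ⟨y, _, hy⟩ | ⟨e', he, hy⟩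
    · cases hy
    · cases hy
      rw [← show e.comp K = _ from he]
      exact R.branch_lev_subset e hn hm (R.vert_mem_branch_self _)

/-- The continuous extension of a proper map to the end compactification is the induced map on
the ends. -/
theorem toHat_ofEnd (R : Rooting G) (p : PH (Realization G)) (e : Ends (Realization G)) :
    p.toHat (EndCompactification.ofEnd e) = EndCompactification.ofEnd (p.toMap.endMap e) := by
  have hlim := (p.toHat.continuous.tendsto _).comp (R.tendsto_vert_lev e)
  have hev : ∀ n, ∀ᶠ m in atTop, p.toMap.1 (Realization.vert G (R.lev e m)) ∈
      R.branch (R.lev (p.toMap.endMap e) n) := by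
    intro n
    obtain ⟨M, hM⟩ := R.exists_mapsTo_branch_endMap R p.toMap n
    filter_upwards [eventually_ge_atTop M] with m hm
    exact hM e m hm (R.vert_mem_branch_self _)
  have hnear : ∀ O, IsOpen O → p.toHat (EndCompactification.ofEnd e) ∈ O →
      ∀ᶠ m in atTop, EndCompactification.ofPoint
        (p.toMap.1 (Realization.vert G (R.lev e m))) ∈ O := by
    intro O hO hz
    filter_upwards [hlim.eventually (hO.mem_nhds hz)] with m hm
    rwa [Function.comp_apply, p.toHat_ofPoint] at hm
  rcases hz : p.toHat (EndCompactification.ofEnd e) with y | e'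
  · exfalso
    obtain ⟨n, hn⟩ := R.exists_mem_ball y
    have hO : IsOpen (EndCompactification.ofPoint '' R.openBall n) :=
      isOpen_generateFrom_of_mem (Or.inl ⟨_, R.isOpen_openBall n, rfl⟩)
    have hmem : p.toHat (EndCompactification.ofEnd e) ∈
        EndCompactification.ofPoint '' R.openBall n := by
      rw [hz]
      exact ⟨y, R.ball_subset_openBall n hn, rfl⟩
    obtain ⟨m, hm, hm'⟩ := ((hnear _ hO hmem).and (hev (n + 1))).exists
    obtain ⟨y', hy', h⟩ := hm
    cases h
    exact R.branch_subset_compl_ball (R.depth_lev _ _).ge hm' (R.openBall_subset_ball n hy')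
  · refine congrArg EndCompactification.ofEnd (R.ends_ext fun n => ?_)
    have hmem : p.toHat (EndCompactification.ofEnd e) ∈ R.hatBranch (R.lev e' n) := by
      rw [hz]
      exact R.ofEnd_mem_hatBranch.2 (by rw [depth_lev])
    obtain ⟨m, hm, hm'⟩ := ((hnear _ (R.isOpen_hatBranch _) hmem).and (hev n)).exists
    exact R.eq_of_mem_branch (R.ofPoint_mem_hatBranch.1 hm) hm' (by rw [depth_lev, depth_lev])

/-- The action of a mapping class on the ends, seen up to depth `k`, is locally constant. -/
theorem isOpen_setOf_lev_smul_eq (k : ℕ) (c : Ends (Realization G) → V) :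
    IsOpen {h : Maps (Realization G) | ∀ e : Ends (Realization G), R.lev (h • e) k = c e} := by
  rw [isOpen_coinduced]
  refine isOpen_iff_forall_mem_open.2 fun p hp => ?_
  have hp' : ∀ e, R.lev (p.toMap.endMap e) k = c e := hp
  -- the ends that `p` takes into the branch at `w`
  let C : V → Set (EndCompactification (Realization G)) := fun w =>
    EndCompactification.ofEnd '' {e | c e = w}
  have hC : ∀ w, IsCompact (C w) := by
    intro w
    have : C w = range EndCompactification.ofEnd \
        ⋃ w' ∈ {w' | R.depth w' = k ∧ w' ≠ w}, p.toHat ⁻¹' R.hatBranch w' := by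
      ext z
      constructor
      · rintro ⟨e, he, rfl⟩
        refine ⟨⟨e, rfl⟩, fun hmem => ?_⟩
        simp only [mem_iUnion, exists_prop] at hmem
        obtain ⟨w', ⟨hk, hne⟩, hw'⟩ := hmem
        rw [mem_preimage, R.toHat_ofEnd, ofEnd_mem_hatBranch, hk, hp'] at hw'
        exact hne (hw'.symm.trans he)
      · rintro ⟨⟨e, rfl⟩, hmem⟩
        refine ⟨e, ?_, rfl⟩
        by_contra hne
        refine hmem (mem_biUnion (x := c e) ⟨by rw [← hp', depth_lev], hne⟩ ?_)
        rw [mem_preimage, R.toHat_ofEnd, ofEnd_mem_hatBranch, ← hp', depth_lev]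
    rw [this]
    exact R.isCompact_range_ofEnd.diff
      (isOpen_biUnion fun w' _ => (R.isOpen_hatBranch w').preimage p.toHat.continuous)
  refine ⟨⋂ w ∈ {w | R.depth w = k}, {q : PH (Realization G) |
    MapsTo q.toHat (C w) (R.hatBranch w)}, ?_, ?_, ?_⟩
  · intro q hq e
    simp only [mem_iInter] at hq
    have hk : R.depth (c e) = k := by rw [← hp', depth_lev]
    have := hq (c e) hk ⟨e, rfl, rfl⟩
    rwa [R.toHat_ofEnd, ofEnd_mem_hatBranch, hk] at this
  · refine (R.finite_level k).isOpen_biInter fun w _ => ?_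
    exact (ContinuousMap.isOpen_setOfPred_mapsTo (hC w) (R.isOpen_hatBranch w)).preimage
      (continuous_fst.comp continuous_induced_dom)
  · simp only [mem_iInter]
    rintro w hw _ ⟨e, he, rfl⟩
    rw [R.toHat_ofEnd, ofEnd_mem_hatBranch, show R.depth w = k from hw, hp']
    exact he

theorem finite_lev_smul {H : Set (Maps (Realization G))} (hH : IsCompact H) (k : ℕ) :
    ((fun (h : Maps (Realization G)) (e : Ends (Realization G)) =>
      R.lev (h • e) k) '' H).Finite := by
  obtain ⟨s, hs⟩ := hH.elim_finite_subcover
    (fun c : Ends (Realization G) → V => {h : Maps (Realization G) | ∀ e : Ends (Realization G),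
      R.lev (h • e) k = c e})
    (R.isOpen_setOf_lev_smul_eq k)
    (fun h _ => mem_iUnion.2 ⟨fun e => R.lev (h • e) k, fun _ => rfl⟩)
  refine s.finite_toSet.subset ?_
  rintro _ ⟨h, hh, rfl⟩
  obtain ⟨c, hc, hcs⟩ := mem_iUnion₂.1 (hs hh)
  have hc' : (fun e : Ends (Realization G) => R.lev (h • e) k) = c := funext hcs
  exact Set.mem_of_eq_of_mem hc' hc

end Rooting

/-! ### Simplicial maps -/

namespace Rooting

variable {G : SimpleGraph V} (R : Rooting G) {G' : SimpleGraph W} (S : Rooting G')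

theorem sum_fiber_pt (π : V → W) (hfin : ∀ w, (π ⁻¹' {w}).Finite) (v : V) (t : I) (w : W) :
    ∑ u ∈ (hfin w).toFinset, (R.pt v t).1 u =
      (if w = π (R.parent v) then 1 - (t : ℝ) else 0) + (if w = π v then (t : ℝ) else 0) := by
  simp only [pt_apply, Finset.sum_add_distrib, Finset.sum_ite_eq', Finite.mem_toFinset,
    mem_preimage, mem_singleton_iff, @eq_comm _ w]

/-- The affine extension to realizations of a map `π` of vertices that takes the two ends of each
edge either to the same vertex or to a vertex and its parent, in the same order. Finite fibres make
it proper. -/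
noncomputable def simplicialMap (π : V → W)
    (hπ : ∀ v, π (R.parent v) = π v ∨ π (R.parent v) = S.parent (π v))
    (hfin : ∀ w, (π ⁻¹' {w}).Finite) : ProperMap (Realization G) (Realization G') := by
  refine ⟨⟨fun x => ⟨fun w => ∑ v ∈ (hfin w).toFinset, x.1 v, ?_⟩, ?_⟩, ?_⟩
  · obtain ⟨y, hy⟩ : ∃ y : Realization G', y.1 = fun w => ∑ v ∈ (hfin w).toFinset, x.1 v := by
      obtain ⟨v, t, ht, rfl⟩ := R.exists_eq_pt x
      simp only [R.sum_fiber_pt π hfin]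
      rcases hπ v with h | h
      · refine ⟨Realization.vert G' (π v), funext fun w => ?_⟩
        rw [h]
        by_cases hw : w = π v <;> simp [Realization.vert, hw]
      · refine ⟨S.pt (π v) t, funext fun w => ?_⟩
        rw [h, pt_apply]
    exact hy ▸ y.2
  · refine Continuous.subtype_mk (continuous_pi fun w => continuous_finsetSum _ fun v _ => ?_) _
    exact (continuous_apply v).comp continuous_subtype_val
  · refine S.isProperMap_of_preimage_ball (ContinuousMap.continuous _) fun n => ?_
    have hn : {v | S.depth (π v) < n}.Finite := by
      refine ((S.finite_depth_lt n).biUnion fun w _ => hfin w).subset fun v hv => ?_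
      exact mem_biUnion (x := π v) hv rfl
    refine ⟨_, R.isCompact_ball (hn.toFinset.sup R.depth + 1), fun x hx v hv => ?_⟩
    by_contra hxv
    have hd : n ≤ S.depth (π v) := by
      by_contra! hlt
      have := Finset.le_sup (f := R.depth) (hn.mem_toFinset.2 hlt)
      omega
    have h0 : ∑ u ∈ (hfin (π v)).toFinset, x.1 u = 0 := hx (π v) hd
    rw [Finset.sum_eq_zero_iff_of_nonneg fun u _ => R.val_nonneg x u] at h0
    exact hxv (h0 v (by simp))

variable {π : V → W} {hπ : ∀ v, π (R.parent v) = π v ∨ π (R.parent v) = S.parent (π v)}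
  {hfin : ∀ w, (π ⁻¹' {w}).Finite}

theorem simplicialMap_vert (v : V) : (R.simplicialMap S π hπ hfin).1 (Realization.vert G v) =
    Realization.vert G' (π v) := by
  refine Subtype.ext (funext fun w => ?_)
  change ∑ u ∈ (hfin w).toFinset, (Realization.vert G v).1 u = _
  rw [← R.pt_one, R.sum_fiber_pt π hfin]
  simp [Realization.vert, Pi.single_apply]

theorem lev_endMap_simplicialMap {e : Ends (Realization G)} {w : W}
    (h : ∀ M, ∃ m, M ≤ m ∧ S.IsAnc w (π (R.lev e m))) :
    S.lev ((R.simplicialMap S π hπ hfin).endMap e) (S.depth w) = w := by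
  refine R.lev_endMap_eq S _ e fun M => ?_
  obtain ⟨m, hm, hw⟩ := h M
  exact ⟨m, hm, by rwa [simplicialMap_vert, vert_mem_branch]⟩

theorem realizationMap_vert {G : SimpleGraph V} {G' : SimpleGraph W} (φ : G ≃g G') (v : V) :
    realizationMap φ (Realization.vert G v) = Realization.vert G' (φ v) :=
  Subtype.ext (single_comp_symm φ.toEquiv v)

/-- An isomorphism of rooted trees acts on ends as it does on the rays from the root. -/
theorem lev_endMap_realizationHomeomorph (φ : G ≃g G') (hparent : ∀ v, φ (R.parent v) =
    S.parent (φ v)) (hdepth : ∀ v, S.depth (φ v) = R.depth v) (e : Ends (Realization G)) (n : ℕ) :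
    S.lev ((ProperMap.ofHomeomorph (realizationHomeomorph φ)).endMap e) n = φ (R.lev e n) := by
  have hit : ∀ k v, φ (R.parent^[k] v) = S.parent^[k] (φ v) := fun k v =>
    (Function.Semiconj.iterate_right (f := φ) (show Function.Semiconj φ R.parent S.parent from
      hparent) k) v
  have := R.lev_endMap_eq S (ProperMap.ofHomeomorph (realizationHomeomorph φ)) e
    (w := φ (R.lev e n)) fun M => by
      refine ⟨max M n, le_max_left _ _, ?_⟩
      change realizationMap φ _ ∈ _
      rw [realizationMap_vert, vert_mem_branch, IsAnc, hdepth, depth_lev,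
        ← R.anc_lev e (le_max_right M n), anc, anc, hit, hdepth]
  rwa [hdepth, depth_lev] at this

end Rooting

/-! ### The tree of a sequence of partitions of the ends -/

namespace Rooting

variable {G : SimpleGraph V}

/-- A sequence of successively finer partitions of the space of ends of a rooted tree, starting
from the trivial one, such that the `n`-th partition is finer than the partition of the ends by
vertices of depth `n`, and is coarser than the one by vertices of depth `m` for some `m`. -/
structure EndPartition (R : Rooting G) where
  rel : ℕ → Setoid (Ends (Realization G))
  rel_zero : ∀ e e', rel 0 e e'
  rel_of_succ : ∀ n e e', rel (n + 1) e e' → rel n e e'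
  lev_eq : ∀ n e e', rel n e e' → R.lev e n = R.lev e' n
  exists_rel_of_lev_eq : ∀ n, ∃ m, ∀ e e', R.lev e m = R.lev e' m → rel n e e'

namespace EndPartition

variable {R : Rooting G} (P : R.EndPartition)

theorem rel_mono {m n : ℕ} (h : m ≤ n) {e e' : Ends (Realization G)} (he : P.rel n e e') :
    P.rel m e e' := by
  induction n, h using Nat.le_induction with
  | base => exact he
  | succ n _ ih => exact ih (P.rel_of_succ n e e' he)

/-- The vertices of depth `n` of the tree of partitions are the classes of the `n`-th partition. -/
abbrev Vertex : Type u := Σ n, Quotient (P.rel n)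

/-- The class of an end `e` in the `n`-th partition. -/
def classOf (n : ℕ) (e : Ends (Realization G)) : P.Vertex := ⟨n, Quotient.mk _ e⟩

theorem exists_eq_classOf (x : P.Vertex) : ∃ e, x = P.classOf x.1 e := by
  obtain ⟨n, q⟩ := x
  induction q using Quotient.inductionOn with
  | h e => exact ⟨e, rfl⟩

theorem classOf_eq_classOf {n : ℕ} {e e' : Ends (Realization G)} :
    P.classOf n e = P.classOf n e' ↔ P.rel n e e' := by
  constructor
  · intro h
    exact Quotient.exact (eq_of_heq (Sigma.mk.inj h).2)
  · intro h
    exact congrArg (Sigma.mk n) (Quotient.sound h)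

/-- The class in the previous partition that contains a given class. -/
def parent : P.Vertex → P.Vertex
  | ⟨0, q⟩ => ⟨0, q⟩
  | ⟨n + 1, q⟩ => ⟨n, Quotient.map id (fun e e' h => P.rel_of_succ n e e' h) q⟩

theorem parent_classOf (n : ℕ) (e : Ends (Realization G)) :
    P.parent (P.classOf (n + 1) e) = P.classOf n e := rfl

theorem fst_parent (x : P.Vertex) : (P.parent x).1 = x.1 - 1 := by
  obtain ⟨_ | n, q⟩ := x <;> rfl

/-- The tree of a sequence of partitions of the ends: each class is joined to the class of the
previous partition that contains it. -/
def graph : SimpleGraph P.Vertex where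
  Adj x y := (x.1 ≠ 0 ∧ P.parent x = y) ∨ (y.1 ≠ 0 ∧ P.parent y = x)
  symm := ⟨fun _ _ h => h.symm⟩
  loopless := ⟨fun x h => by
    have h' : x.1 ≠ 0 ∧ P.parent x = x := h.elim id id
    have := congrArg Sigma.fst h'.2
    rw [fst_parent] at this
    exact h'.1 (by omega)⟩

theorem finite_quotient (n : ℕ) : Finite (Quotient (P.rel n)) := by
  obtain ⟨m, hm⟩ := P.exists_rel_of_lev_eq n
  have := (R.finite_level m).to_subtype
  refine Finite.of_injective (β := {v | R.depth v = m})
    (fun q => ⟨R.lev q.out m, R.depth_lev _ _⟩) fun q q' h => ?_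
  rw [← q.out_eq, ← q'.out_eq]
  exact Quotient.sound (hm _ _ (congrArg Subtype.val h))

/-- The tree of partitions, rooted at the single class of the trivial partition. -/
noncomputable def rooting [Nonempty (Ends (Realization G))] : Rooting P.graph where
  root := P.classOf 0 (Classical.arbitrary _)
  parent := P.parent
  depth x := x.1
  depth_eq_zero_iff x := by
    constructor
    · intro h
      obtain ⟨e, he⟩ := P.exists_eq_classOf x
      rw [he, h]
      exact P.classOf_eq_classOf.2 (P.rel_zero _ _)
    · rintro rfl; rfl
  depth_parent := P.fst_parent
  adj_iff x y := by
    have h : ∀ x : P.Vertex, x ≠ P.classOf 0 (Classical.arbitrary _) ↔ x.1 ≠ 0 := by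
      intro x
      rw [not_iff_not]
      refine ⟨by rintro rfl; rfl, fun h => ?_⟩
      obtain ⟨e, he⟩ := P.exists_eq_classOf x
      rw [he, h]
      exact P.classOf_eq_classOf.2 (P.rel_zero _ _)
    rw [h, h]
    rfl
  finite_level n := by
    have := P.finite_quotient n
    refine (finite_range (Sigma.mk (β := fun n => Quotient (P.rel n)) n)).subset ?_
    rintro ⟨_, q⟩ rfl
    exact ⟨q, rfl⟩

section

variable [Nonempty (Ends (Realization G))]

theorem anc_classOf (e : Ends (Realization G)) {m n : ℕ} (h : m ≤ n) :
    P.rooting.anc (P.classOf n e) m = P.classOf m e := by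
  have key : ∀ k, P.parent^[k] (P.classOf (m + k) e) = P.classOf m e := by
    intro k
    induction k with
    | zero => rfl
    | succ k ih => rw [Function.iterate_succ_apply]; exact ih
  have := key (n - m)
  rwa [Nat.add_sub_cancel' h] at this

theorem isAnc_classOf (e : Ends (Realization G)) {m n : ℕ} (h : m ≤ n) :
    P.rooting.IsAnc (P.classOf m e) (P.classOf n e) :=
  P.anc_classOf e h

theorem exists_lev_eq_classOf (ε : Ends (Realization P.graph)) (n : ℕ) :
    ∃ e, ∀ m ≤ n, P.rooting.lev ε m = P.classOf m e := by
  obtain ⟨e, he⟩ := P.exists_eq_classOf (P.rooting.lev ε n)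
  rw [show (P.rooting.lev ε n).1 = n from P.rooting.depth_lev ε n] at he
  exact ⟨e, fun m hm => by rw [← P.rooting.anc_lev ε hm, he, P.anc_classOf e hm]⟩

end

/-- The vertex of depth `n` beyond which the ends of a class of the `n`-th partition lie. -/
noncomputable def toVertex (x : P.Vertex) : V :=
  Quotient.lift (fun e => R.lev e x.1) (P.lev_eq x.1) x.2

theorem toVertex_classOf (n : ℕ) (e : Ends (Realization G)) :
    P.toVertex (P.classOf n e) = R.lev e n := rfl

theorem depth_toVertex (x : P.Vertex) : R.depth (P.toVertex x) = x.1 := by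
  obtain ⟨e, he⟩ := P.exists_eq_classOf x
  rw [he, toVertex_classOf, depth_lev]
  rfl

theorem toVertex_parent (x : P.Vertex) : P.toVertex (P.parent x) = R.parent (P.toVertex x) := by
  obtain ⟨n, q⟩ := x
  obtain ⟨e, rfl⟩ : ∃ e, Quotient.mk _ e = q := Quotient.exists_rep q
  rcases n with _ | n
  · change R.lev e 0 = R.parent (R.lev e 0)
    rw [lev_zero, parent_root]
  · exact (R.parent_lev e n).symm

/-- The simplicial map to the original tree that takes a class of ends to the vertex of the same
depth beyond which its ends lie. -/
noncomputable def toTree [Nonempty (Ends (Realization G))] :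
    ProperMap (Realization P.graph) (Realization G) :=
  P.rooting.simplicialMap R P.toVertex (fun x => Or.inr (P.toVertex_parent x)) fun v =>
    (P.rooting.finite_level (R.depth v)).subset fun x hx => by
      rw [mem_preimage, mem_singleton_iff] at hx
      rw [← hx, depth_toVertex]
      rfl

theorem lev_toTree [Nonempty (Ends (Realization G))] (ε : Ends (Realization P.graph)) (n : ℕ) :
    R.lev (P.toTree.endMap ε) n = P.toVertex (P.rooting.lev ε n) := by
  have h : R.depth (P.toVertex (P.rooting.lev ε n)) = n := by
    rw [depth_toVertex]; exact P.rooting.depth_lev ε n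
  rw [← P.rooting.lev_endMap_simplicialMap R (π := P.toVertex) (e := ε)
    (w := P.toVertex (P.rooting.lev ε n)) fun M => ?_, h]
  · rfl
  · refine ⟨max M n, le_max_left _ _, ?_⟩
    obtain ⟨e, he⟩ := P.exists_lev_eq_classOf ε (max M n)
    rw [he _ le_rfl, he n (le_max_right _ _)]
    exact R.isAnc_lev e (le_max_right _ _)

end EndPartition

/-- A vertex of a rooted tree is live if there is an end beyond it. -/
def IsLive (R : Rooting G) (v : V) : Prop := ∃ e, R.lev e (R.depth v) = v

section Live

variable (R : Rooting G)

theorem isLive_lev (e : Ends (Realization G)) (n : ℕ) : R.IsLive (R.lev e n) :=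
  ⟨e, by rw [depth_lev]⟩

variable {R} in
theorem IsLive.parent {v : V} (h : R.IsLive v) : R.IsLive (R.parent v) := by
  obtain ⟨e, he⟩ := h
  rw [← he]
  rcases R.depth v with _ | n
  · rw [lev_zero, parent_root, ← R.lev_zero e]
    exact R.isLive_lev e 0
  · rw [parent_lev]
    exact R.isLive_lev e n

theorem exists_isLive_iterate [Nonempty (Ends (Realization G))] (v : V) :
    ∃ i, R.IsLive (R.parent^[i] v) := by
  refine ⟨R.depth v, ?_⟩
  have : R.parent^[R.depth v] v = R.root := by
    rw [← R.depth_eq_zero_iff, R.depth_iterate, Nat.sub_self]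
  rw [this, ← R.lev_zero (Classical.arbitrary _)]
  exact R.isLive_lev _ _

variable [Nonempty (Ends (Realization G))]

/-- The last vertex on the path from the root to `v` that has an end beyond it. -/
noncomputable def lastLive (v : V) : V := R.parent^[Nat.find (R.exists_isLive_iterate v)] v

theorem isLive_lastLive (v : V) : R.IsLive (R.lastLive v) :=
  Nat.find_spec (R.exists_isLive_iterate v)

variable {R} in
theorem IsLive.lastLive_eq {v : V} (h : R.IsLive v) : R.lastLive v = v := by
  rw [lastLive, (Nat.find_eq_zero (R.exists_isLive_iterate v)).2 h]
  rfl

theorem lastLive_parent {v : V} (h : ¬ R.IsLive v) : R.lastLive (R.parent v) = R.lastLive v := by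
  rw [lastLive, lastLive, Nat.find_comp_succ (R.exists_isLive_iterate v)
    (R.exists_isLive_iterate (R.parent v)) h, Function.iterate_succ_apply]
  rfl

theorem exists_depth_le_lastLive (n : ℕ) :
    ∃ N, ∀ v, N ≤ R.depth v → n ≤ R.depth (R.lastLive v) := by
  obtain ⟨N, hnN, hN⟩ := R.exists_depth_forall_exists_end n
  refine ⟨N, fun v hv => ?_⟩
  have hlive : R.IsLive (R.parent^[R.depth v - n] v) := by
    obtain ⟨e, he⟩ := hN v hv
    rw [show R.parent^[R.depth v - n] v = R.anc v n from rfl, ← he]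
    exact R.isLive_lev e n
  have := Nat.find_min' (R.exists_isLive_iterate v) hlive
  rw [lastLive, depth_iterate]
  omega

end Live

namespace EndPartition

variable {R : Rooting G} (P : R.EndPartition)

/-- There is a function `k` that increases in steps of at most one, tends to infinity, and grows so
slowly that ends with a common vertex of depth `m` lie in a common class of the `k m`-th partition:
it is increased whenever this is possible. -/
theorem exists_speed : ∃ k : ℕ → ℕ, (∀ m, k (m + 1) = k m ∨ k (m + 1) = k m + 1) ∧
    (∀ n, ∃ m, n ≤ k m) ∧ ∀ m e e', R.lev e m = R.lev e' m → P.rel (k m) e e' := by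
  let Q : ℕ → ℕ → Prop := fun m n => ∀ e e', R.lev e m = R.lev e' m → P.rel n e e'
  have hQ : ∀ {m m' n}, m ≤ m' → Q m n → Q m' n := by
    intro m m' n hm h e e' he
    exact h e e' (by rw [← R.anc_lev e hm, he, R.anc_lev e' hm])
  let k : ℕ → ℕ := fun m => Nat.rec 0 (fun m km => if Q (m + 1) (km + 1) then km + 1 else km) m
  have hk : ∀ m, k (m + 1) = if Q (m + 1) (k m + 1) then k m + 1 else k m := fun m => rfl
  have hstep : ∀ m, k (m + 1) = k m ∨ k (m + 1) = k m + 1 := by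
    intro m
    rw [hk]
    split_ifs <;> simp
  have hmono : Monotone k := monotone_nat_of_le_succ fun m => by
    rcases hstep m with h | h <;> omega
  refine ⟨k, hstep, fun n => ?_, fun m => ?_⟩
  · induction n with
    | zero => exact ⟨0, Nat.zero_le _⟩
    | succ n ih =>
      obtain ⟨m, hm⟩ := ih
      obtain ⟨m', hm'⟩ := P.exists_rel_of_lev_eq (n + 1)
      by_contra! hcon
      have h₁ : k (max m m') = n := by
        have := hmono (le_max_left m m')
        have := hcon (max m m')
        omega
      have h₂ := hk (max m m')
      rw [h₁, if_pos (hQ ((le_max_right m m').trans (Nat.le_succ _)) hm')] at h₂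
      have := hcon (max m m' + 1)
      omega
  · change Q m (k m)
    induction m with
    | zero => exact fun e e' _ => P.rel_zero e e'
    | succ m ih =>
      rw [hk]
      split_ifs with h
      · exact h
      · exact hQ (Nat.le_succ m) ih

/-- The slow-down function of `exists_speed`. -/
noncomputable def speed : ℕ → ℕ := P.exists_speed.choose

theorem speed_succ (m : ℕ) : P.speed (m + 1) = P.speed m ∨ P.speed (m + 1) = P.speed m + 1 :=
  P.exists_speed.choose_spec.1 m

theorem exists_le_speed (n : ℕ) : ∃ m, n ≤ P.speed m := P.exists_speed.choose_spec.2.1 n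

theorem rel_speed {m : ℕ} {e e' : Ends (Realization G)} (h : R.lev e m = R.lev e' m) :
    P.rel (P.speed m) e e' :=
  P.exists_speed.choose_spec.2.2 m e e' h

theorem speed_mono : Monotone P.speed := monotone_nat_of_le_succ fun m => by
  rcases P.speed_succ m with h | h <;> omega

section

variable [Nonempty (Ends (Realization G))]

/-- The image of a vertex in the tree of partitions: for a vertex of depth `m` with an end `e`
beyond it, the class of `e` in the partition of index `speed m`. Finite branches are collapsed. -/
noncomputable def ofVertex (v : V) : P.Vertex :=
  P.classOf (P.speed (R.depth (R.lastLive v))) (R.isLive_lastLive v).choose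

theorem ofVertex_eq {v : V} {e : Ends (Realization G)} (he : R.lev e (R.depth v) = v) :
    P.ofVertex v = P.classOf (P.speed (R.depth v)) e := by
  have hv : R.lastLive v = v := IsLive.lastLive_eq ⟨e, he⟩
  have hc := (R.isLive_lastLive v).choose_spec
  rw [ofVertex]
  set e' := (R.isLive_lastLive v).choose
  rw [hv] at hc ⊢
  exact P.classOf_eq_classOf.2 (P.rel_speed (hc.trans he.symm))

theorem ofVertex_lev (e : Ends (Realization G)) (m : ℕ) :
    P.ofVertex (R.lev e m) = P.classOf (P.speed m) e := by
  rw [P.ofVertex_eq (e := e) (by rw [depth_lev]), depth_lev]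

theorem ofVertex_parent (v : V) : P.ofVertex (R.parent v) = P.ofVertex v ∨
    P.ofVertex (R.parent v) = P.parent (P.ofVertex v) := by
  by_cases hv : R.IsLive v
  · obtain ⟨e, he⟩ := hv
    rw [← he]
    rcases R.depth v with _ | m
    · rw [lev_zero, parent_root]
      exact Or.inl rfl
    · rw [parent_lev, ofVertex_lev, ofVertex_lev]
      rcases P.speed_succ m with h | h
      · exact Or.inl (by rw [h])
      · exact Or.inr (by rw [h, parent_classOf])
  · left
    rw [ofVertex, ofVertex]
    simp only [R.lastLive_parent hv]

/-- The simplicial map from the original tree to the tree of partitions. -/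
noncomputable def ofTree : ProperMap (Realization G) (Realization P.graph) :=
  R.simplicialMap P.rooting P.ofVertex P.ofVertex_parent fun x => by
    obtain ⟨m, hm⟩ := P.exists_le_speed (x.1 + 1)
    obtain ⟨N, hN⟩ := R.exists_depth_le_lastLive m
    refine (R.finite_depth_lt N).subset fun v hv => ?_
    by_contra hlt
    have h₁ := P.speed_mono (hN v (not_lt.1 hlt))
    have h₂ : P.speed (R.depth (R.lastLive v)) = x.1 := congrArg Sigma.fst hv
    omega

theorem lev_ofTree (e : Ends (Realization G)) (n : ℕ) :
    P.rooting.lev (P.ofTree.endMap e) n = P.classOf n e := by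
  refine R.lev_endMap_simplicialMap P.rooting (π := P.ofVertex) (w := P.classOf n e) fun M => ?_
  obtain ⟨m, hm⟩ := P.exists_le_speed n
  refine ⟨max M m, le_max_left _ _, ?_⟩
  rw [ofVertex_lev]
  exact P.isAnc_classOf e (hm.trans (P.speed_mono (le_max_right _ _)))

theorem endMap_toTree_ofTree (e : Ends (Realization G)) :
    P.toTree.endMap (P.ofTree.endMap e) = e := by
  refine R.ends_ext fun n => ?_
  rw [lev_toTree, lev_ofTree, toVertex_classOf]

theorem endMap_ofTree_toTree (ε : Ends (Realization P.graph)) :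
    P.ofTree.endMap (P.toTree.endMap ε) = ε := by
  refine P.rooting.ends_ext fun n => ?_
  rw [lev_ofTree]
  obtain ⟨m, hm⟩ := P.exists_le_speed n
  -- a representative `e` of the class of `ε` at a great depth has the same class as `toTree ε`
  obtain ⟨e, he⟩ := P.exists_lev_eq_classOf ε (max n m)
  rw [he n (le_max_left _ _), classOf_eq_classOf]
  refine P.rel_mono hm (P.rel_speed ?_)
  rw [lev_toTree, he m (le_max_right _ _), toVertex_classOf]

/-- The proper homotopy equivalence of a tree with the tree of a sequence of partitions. -/
noncomputable def properHomotopyEquiv :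
    ProperHomotopyEquiv (Realization G) (Realization P.graph) where
  toMap := P.ofTree
  invMap := P.toTree
  inv_comp := R.properlyHomotopic_of_endMap_eq R (g := ProperMap.id) fun e => by
    rw [ProperMap.endMap_comp, endMap_toTree_ofTree, ProperMap.endMap_id]
  comp_inv := P.rooting.properlyHomotopic_of_endMap_eq P.rooting (g := ProperMap.id) fun ε => by
    rw [ProperMap.endMap_comp, endMap_ofTree_toTree, ProperMap.endMap_id]

end

/-- The automorphism of the tree of partitions induced by a permutation of the ends that preserves
each of the partitions. -/
def graphIso (a : Equiv.Perm (Ends (Realization G)))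
    (ha : ∀ n e e', P.rel n e e' ↔ P.rel n (a e) (a e')) : P.graph ≃g P.graph where
  toEquiv := Equiv.sigmaCongrRight fun n => Quotient.congr a (ha n)
  map_rel_iff' {x y} := by
    have hp : ∀ x : P.Vertex, P.parent (Equiv.sigmaCongrRight (fun n => Quotient.congr a (ha n)) x)
        = Equiv.sigmaCongrRight (fun n => Quotient.congr a (ha n)) (P.parent x) := by
      rintro ⟨_ | n, q⟩
      · rfl
      · obtain ⟨e, rfl⟩ := Quotient.exists_rep q
        rfl
    simp only [graph, hp, EmbeddingLike.apply_eq_iff_eq]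
    rfl

variable {a : Equiv.Perm (Ends (Realization G))}
  {ha : ∀ n e e', P.rel n e e' ↔ P.rel n (a e) (a e')}

theorem graphIso_classOf (n : ℕ) (e : Ends (Realization G)) :
    P.graphIso a ha (P.classOf n e) = P.classOf n (a e) := rfl

theorem graphIso_parent (x : P.Vertex) :
    P.graphIso a ha (P.parent x) = P.parent (P.graphIso a ha x) := by
  obtain ⟨e, he⟩ := P.exists_eq_classOf x
  rw [he]
  rcases x.1 with _ | n <;> rfl

theorem graphIso_ext {φ ψ : P.graph ≃g P.graph}
    (h : ∀ n e, φ (P.classOf n e) = ψ (P.classOf n e)) : φ = ψ := by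
  refine RelIso.ext fun x => ?_
  obtain ⟨e, he⟩ := P.exists_eq_classOf x
  rw [he, h]

/-- Under the equivalence of the original tree with the tree of partitions, the permutation `a` of
the ends corresponds to the action of the induced automorphism on the ends. -/
theorem endMap_graphIso [Nonempty (Ends (Realization G))] (ε : Ends (Realization P.graph)) :
    (ProperMap.ofHomeomorph (realizationHomeomorph (P.graphIso a ha))).endMap ε =
      P.ofTree.endMap (a (P.toTree.endMap ε)) := by
  refine P.rooting.ends_ext fun n => ?_
  rw [P.rooting.lev_endMap_realizationHomeomorph P.rooting (P.graphIso a ha) P.graphIso_parent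
    fun _ => rfl, lev_ofTree, ← graphIso_classOf (a := a) (ha := ha), ← lev_ofTree,
    endMap_ofTree_toTree]

end EndPartition

end Rooting

/-! ### Realization of compact groups of mapping classes -/

namespace Rooting

variable {G : SimpleGraph V}

/-- The partitions of the space of ends into classes of ends that no element of the compact group
`H` can distinguish by vertices of depth `n`. -/
def orbitPartition (R : Rooting G) {H : Subgroup (Maps (Realization G))}
    (hH : IsCompact (H : Set (Maps (Realization G)))) : R.EndPartition where
  rel n :=
    { r := fun e e' => ∀ h ∈ H, R.lev (h • e) n = R.lev (h • e') n
      iseqv := ⟨fun _ _ _ => rfl, fun he h hh => (he h hh).symm,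
        fun he he' h hh => (he h hh).trans (he' h hh)⟩ }
  rel_zero e e' h _ := by rw [lev_zero, lev_zero]
  rel_of_succ n e e' he h hh := by rw [← parent_lev, he h hh, parent_lev]
  lev_eq n e e' he := by simpa using he 1 H.one_mem
  exists_rel_of_lev_eq n := by
    -- by compactness, finitely many elements of `H` suffice to define the `n`-th partition
    have hM : ∀ c : Ends (Realization G) → V, ∃ m,
        c ∈ (fun (h : Maps (Realization G)) (e : Ends (Realization G)) => R.lev (h • e) n) '' H →
        ∀ e e', R.lev e m = R.lev e' m → c e = c e' := by
      intro c
      by_cases hc : c ∈ (fun (h : Maps (Realization G)) (e : Ends (Realization G)) =>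
        R.lev (h • e) n) '' H
      · obtain ⟨h, _, rfl⟩ := hc
        obtain ⟨f, hf⟩ := Quotient.exists_rep (Units.val h : ProperClass _ _)
        obtain ⟨m, hm⟩ := R.exists_lev_endMap_eq R f n
        refine ⟨m, fun _ e e' he => ?_⟩
        simp only [Maps.smul_def, ← hf]
        exact hm e e' he
      · exact ⟨0, fun h => absurd h hc⟩
    choose M hM using hM
    refine ⟨(R.finite_lev_smul hH n).toFinset.sup M, fun e e' he h hh => ?_⟩
    have hmem := mem_image_of_mem
      (fun (h : Maps (Realization G)) (e : Ends (Realization G)) => R.lev (h • e) n) hh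
    have hle := Finset.le_sup (f := M) ((R.finite_lev_smul hH n).mem_toFinset.2 hmem)
    exact hM _ hmem e e' (by rw [← R.anc_lev e hle, he, R.anc_lev e' hle])

end Rooting

end GraphMaps

open GraphMaps in
theorem mainTheorem6 {V : Type u} (T : SimpleGraph V) (hT : T.IsTree)
    (hfin : ∀ v, (T.neighborSet v).Finite)
    (H : Subgroup (GraphMaps.Maps (GraphMaps.Realization T)))
    (hH : IsCompact (H : Set (GraphMaps.Maps (GraphMaps.Realization T)))) :
    ∃ (W : Type u) (Y : SimpleGraph W),
      Y.IsTree ∧ (∀ w, (Y.neighborSet w).Finite) ∧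
      ∃ (e : GraphMaps.ProperHomotopyEquiv (GraphMaps.Realization T) (GraphMaps.Realization Y))
        (ρ : H →* (Y ≃g Y)),
        ∀ h : H, GraphMaps.autToMaps Y (ρ h) = GraphMaps.mapsCongr e (h : GraphMaps.Maps _) := by
  obtain ⟨r⟩ := hT.connected.nonempty
  obtain ⟨R, -⟩ := Rooting.exists_of_isTree hT hfin r
  rcases isEmpty_or_nonempty (Ends (Realization T)) with hE | hE
  -- without ends, all mapping classes are trivial
  · refine ⟨V, T, hT, hfin, ⟨.id, .id, .refl isProperMap_id, .refl isProperMap_id⟩, 1, fun h => ?_⟩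
    exact Units.ext (R.properClass_eq_of_endMap_eq R fun e => hE.elim e)
  · let P := R.orbitPartition hH
    let S := P.rooting
    have hinv : ∀ (h : H) n e e', P.rel n e e' ↔ P.rel n
        (MulAction.toPerm (h : Maps (Realization T)) e)
        (MulAction.toPerm (h : Maps (Realization T)) e') := by
      have hmap : ∀ (h : H) n e e', P.rel n e e' → P.rel n ((h : Maps (Realization T)) • e)
          ((h : Maps (Realization T)) • e') := by
        intro h n e e' he k hk
        rw [smul_smul, smul_smul]
        exact he _ (H.mul_mem hk h.2)
      refine fun h n e e' => ⟨hmap h n e e', fun he => ?_⟩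
      simpa [smul_smul] using hmap h⁻¹ n _ _ he
    refine ⟨P.Vertex, P.graph, S.isTree, S.finite_neighborSet, P.properHomotopyEquiv,
      ⟨⟨fun h => P.graphIso (MulAction.toPerm (h : Maps (Realization T))) (hinv h), ?_⟩, ?_⟩,
      fun h => ?_⟩
    · refine P.graphIso_ext fun n e => congrArg (P.classOf n) ?_
      exact one_smul (Maps (Realization T)) e
    · intro h k
      refine P.graphIso_ext fun n e => congrArg (P.classOf n) ?_
      exact mul_smul (h : Maps (Realization T)) (k : Maps (Realization T)) e
    · refine Units.ext (S.properClass_eq_of_endMap_eq S fun ε => ?_)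
      refine (P.endMap_graphIso ε).trans ?_
      exact ((ProperClass.endMap_comp _ P.toTree.cls ε).trans
        (ProperClass.endMap_comp P.ofTree.cls _ _)).symm
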